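/- Let $Q$ be a $\mathbb Z^n$-quiver: a quiver whose arrow set is partitioned into $n+1$ parts (arrow types) such that exactly one arrow of each type leaves each vertex; each vertex is connected to each other by an admissible path, i.e. a path avoiding some arrow type; and two paths leaving the same vertex arrive at the same vertex if and only if the numbers of arrows of each type they contain differ by a constant independent of the type. A path is simple if it contains at most one arrow of each type; two distinct vertices connected by a simple path are called neighbors. Let $k$ be a field and $\mathfrak V$ a representation of $Q$ in $k$-vector spaces, with spaces $V_v$ and maps $\varphi_\gamma$ along paths $\gamma$. Assume that $\mathfrak V$ is - a linked net: if $\gamma_1,\gamma_2$ connect the same two vertices and $\gamma_2$ is admissible, then $\varphi_{\gamma_1}$ is a scalar multiple of $\varphi_{\gamma_2}$; $\varphi_\gamma=0$ for each simple non-admissible path $\gamma$; and $\ker\varphi_{\gamma_1}\cap\ker\varphi_{\gamma_2}=0$ if $\gamma_1,\gamma_2$ are admissible paths leaving the same vertex with no arrow type in common; - pure (each epimorphism between two of the spaces $V_v$ is an isomorphism; equivalently, the $V_v$ have the same finite dimension) and nontrivial (this dimension is not zero); - exact: $\operatorname{Im}\varphi_\gamma=\ker\varphi_\delta$ for all neighbors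 $u,v$ and all admissible paths $\gamma$ from $u$ to $v$ and $\delta$ from $v$ to $u$; - finitely generated: there is a finite set $H_0$ of vertices such that each $V_v$ is the sum of the images of the maps along the paths from vertices of $H_0$ to $v$. A representation is generated by a vertex $v$ if each of its spaces is the sum of the images of the maps along the paths from $v$. It is $1$-generated by a set $H$ of vertices if for each vertex $v$ some path from a vertex of $H$ to $v$ induces an epimorphism, and minimally so if it is not $1$-generated by any proper subset of $H$. Let $\mathbb{LP}(\mathfrak V)$ be the $k$-scheme parameterizing the subrepresentations of pure dimension $1$ of $\mathfrak V$, embedded in $\prod_{v\in A}\mathbb P(V_v)$, the product of the projective spaces of lines in the $V_v$, for a set $A$ of vertices $1$-generating $\mathfrak V$. A point of it with values in an extension field $K$ of $k$ is a subrepresentation $\mathfrak W\subseteq\mathfrak V\otimes_kK$ with all spaces of dimension $1$ over $K$; its closed sets are those cut out by multihomogeneous polynomials with coefficients in $k$. For each vertex $v$ let $\mathbb{LP}(\mathfrak V)_v$ be the closure in $\mathbb{LP}(\mathfrak V)$ of the set of the points $\mathfrak W$ generated by $v$. For each finite set $H$ of vertices put $$\mathbb{LP}(\mathfrak V)_H:=\bigcap_{v\in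 H}\mathbb{LP}(\mathfrak V)_v,\qquad \mathbb{LP}(\mathfrak V)^*_H:=\mathbb{LP}(\mathfrak V)_H-\bigcup_{v\notin H}\mathbb{LP}(\mathfrak V)_v$$ (so that $\mathbb{LP}(\mathfrak V)_\emptyset=\mathbb{LP}(\mathfrak V)$). Then, for each finite set $H$ of vertices of $Q$, $$\mathbb{LP}(\mathfrak V)^*_H=\{\mathfrak W\in\mathbb{LP}(\mathfrak V)\mid \mathfrak W\text{ is minimally $1$-generated by }H\}.$$ Furthermore, $\mathbb{LP}(\mathfrak V)^*_H$ is open in $\mathbb{LP}(\mathfrak V)_H$ and, if $H$ is nonempty, dense in it. -/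

import Mathlib

open scoped TensorProduct

universe u w q h

/-! ### Quivers with arrow types -/

section Quivers

variable {Q : Type q} [Quiver.{h} Q] {n : ℕ}

/-- The number of arrows of type `a` in a path, for a partition `ty` of the arrows of the quiver
into parts indexed by `Fin (n + 1)`. -/
def pathType (ty : ∀ ⦃u v : Q⦄, (u ⟶ v) → Fin (n + 1)) (a : Fin (n + 1)) {u : Q} :
    ∀ {v : Q}, Quiver.Path u v → ℕ
  | _, .nil => 0
  | _, .cons γ e => pathType ty a γ + if ty e = a then 1 else 0

/-- A path is admissible if it avoids some arrow type. -/
def IsAdmissible (ty : ∀ ⦃u v : Q⦄, (u ⟶ v) → Fin (n + 1)) {u v : Q} (γ : Quiver.Path u v) :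
    Prop :=
  ∃ a, pathType ty a γ = 0

/-- A path is simple if it contains at most one arrow of each type. -/
def IsSimplePath (ty : ∀ ⦃u v : Q⦄, (u ⟶ v) → Fin (n + 1)) {u v : Q} (γ : Quiver.Path u v) :
    Prop :=
  ∀ a, pathType ty a γ ≤ 1

/-- Two distinct vertices are neighbors if they are connected by a simple path. -/
def AreNeighbors (ty : ∀ ⦃u v : Q⦄, (u ⟶ v) → Fin (n + 1)) (u v : Q) : Prop :=
  u ≠ v ∧ ∃ γ : Quiver.Path u v, IsSimplePath ty γ

end Quivers

/-- The structure of a `ℤⁿ`-quiver on a quiver: a partition of the arrows into `n + 1` arrow types,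
subject to three conditions. -/
structure ZnQuiver (n : ℕ) (Q : Type q) [Quiver.{h} Q] where
  /-- the type of an arrow -/
  ty : ∀ ⦃u v : Q⦄, (u ⟶ v) → Fin (n + 1)
  /-- exactly one arrow of each type leaves each vertex -/
  existsUnique_arrow : ∀ (u : Q) (a : Fin (n + 1)), ∃! e : (Σ v : Q, (u ⟶ v)), ty e.2 = a
  /-- each vertex is connected to each other by an admissible path -/
  exists_admissible : ∀ u v : Q, ∃ γ : Quiver.Path u v, IsAdmissible ty γ
  /-- two paths leaving the same vertex arrive at the same vertex if and only if the difference of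
  their types is constant -/
  same_target_iff : ∀ {u v₁ v₂ : Q} (γ₁ : Quiver.Path u v₁) (γ₂ : Quiver.Path u v₂),
    v₁ = v₂ ↔ ∃ c : ℤ, ∀ a, (pathType ty a γ₁ : ℤ) - pathType ty a γ₂ = c

/-! ### Representations in vector spaces -/

/-- A representation of the quiver `Q` in the category of vector spaces over `k`. -/
structure QuiverRep (k : Type u) [Field k] (Q : Type q) [Quiver.{h} Q] where
  /-- the space at a vertex -/
  V : Q → Type w
  [addCommGroup : ∀ v, AddCommGroup (V v)]
  [module : ∀ v, Module k (V v)]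
  /-- the map at an arrow -/
  map : ∀ ⦃u v : Q⦄, (u ⟶ v) → (V u →ₗ[k] V v)

attribute [instance] QuiverRep.addCommGroup QuiverRep.module

namespace QuiverRep

variable {k : Type u} [Field k] {Q : Type q} [Quiver.{h} Q] {n : ℕ}

/-- The composition of the maps along a path. -/
def pathMap (𝔙 : QuiverRep.{u, w} k Q) {u : Q} :
    ∀ {v : Q}, Quiver.Path u v → (𝔙.V u →ₗ[k] 𝔙.V v)
  | _, .nil => LinearMap.id
  | _, .cons γ e => 𝔙.map e ∘ₗ 𝔙.pathMap γ

/-- Pure: each epimorphism between associated spaces is an isomorphism. -/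
def IsPure (𝔙 : QuiverRep.{u, w} k Q) : Prop :=
  ∀ (u v : Q) (f : 𝔙.V u →ₗ[k] 𝔙.V v), Function.Surjective f → Function.Bijective f

/-- Nontrivial: not all associated spaces are zero. -/
def IsNontrivial (𝔙 : QuiverRep.{u, w} k Q) : Prop :=
  ∃ v : Q, Nontrivial (𝔙.V v)

/-- `𝔙` is generated by the collection `H` of vertices: each space is the sum of the images of the
maps along the paths coming from vertices of `H`. -/
def GeneratedBy (𝔙 : QuiverRep.{u, w} k Q) (H : Set Q) : Prop :=
  ∀ v : Q, (⨆ (u : Q) (_ : u ∈ H) (γ : Quiver.Path u v), LinearMap.range (𝔙.pathMap γ)) = ⊤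

/-- `𝔙` is `1`-generated by the collection `H` of vertices. -/
def OneGeneratedBy (𝔙 : QuiverRep.{u, w} k Q) (H : Set Q) : Prop :=
  ∀ v : Q, ∃ u ∈ H, ∃ γ : Quiver.Path u v, Function.Surjective (𝔙.pathMap γ)

/-- `𝔙` is minimally `1`-generated by `H`: it is `1`-generated by `H` but by no smaller
collection. -/
def MinimallyOneGeneratedBy (𝔙 : QuiverRep.{u, w} k Q) (H : Set Q) : Prop :=
  𝔙.OneGeneratedBy H ∧ ∀ H' : Set Q, H' ⊂ H → ¬ 𝔙.OneGeneratedBy H'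

/-- `𝔙` is generated by a finite set of vertices. -/
def FinitelyGenerated (𝔙 : QuiverRep.{u, w} k Q) : Prop :=
  ∃ H : Set Q, H.Finite ∧ 𝔙.GeneratedBy H

/-- Weakly linked nets over a `ℤⁿ`-quiver. -/
structure IsWeaklyLinkedNet (T : ZnQuiver n Q) (𝔙 : QuiverRep.{u, w} k Q) : Prop where
  smul_admissible : ∀ {u v : Q} (γ₁ γ₂ : Quiver.Path u v), IsAdmissible T.ty γ₂ →
    ∃ c : k, 𝔙.pathMap γ₁ = c • 𝔙.pathMap γ₂
  /-- the map along a minimal circuit, that is, a simple non-admissible path, is zero -/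
  minimal_circuit : ∀ {u v : Q} (γ : Quiver.Path u v), IsSimplePath T.ty γ →
    ¬ IsAdmissible T.ty γ → 𝔙.pathMap γ = 0

/-- Linked nets over a `ℤⁿ`-quiver. -/
structure IsLinkedNet (T : ZnQuiver n Q) (𝔙 : QuiverRep.{u, w} k Q) : Prop
    extends IsWeaklyLinkedNet T 𝔙 where
  /-- admissible paths with no arrow type in common have kernels meeting trivially -/
  ker_inf_ker : ∀ {u v₁ v₂ : Q} (γ₁ : Quiver.Path u v₁) (γ₂ : Quiver.Path u v₂),
    IsAdmissible T.ty γ₁ → IsAdmissible T.ty γ₂ →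
    (∀ a, pathType T.ty a γ₁ = 0 ∨ pathType T.ty a γ₂ = 0) →
    LinearMap.ker (𝔙.pathMap γ₁) ⊓ LinearMap.ker (𝔙.pathMap γ₂) = ⊥

/-- Exactness: for neighbors `u, v`, the image of the map from `u` to `v` along an admissible path
is the kernel of the map from `v` to `u` along an admissible path. -/
def IsExact (T : ZnQuiver n Q) (𝔙 : QuiverRep.{u, w} k Q) : Prop :=
  ∀ (u v : Q), AreNeighbors T.ty u v → ∀ (γ : Quiver.Path u v) (δ : Quiver.Path v u),
    IsAdmissible T.ty γ → IsAdmissible T.ty δ →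
    LinearMap.range (𝔙.pathMap γ) = LinearMap.ker (𝔙.pathMap δ)

/-- The base change of a representation to an extension field. -/
noncomputable def baseChange (𝔙 : QuiverRep.{u, w} k Q) (K : Type u) [Field K] [Algebra k K] :
    QuiverRep.{u, max u w} K Q where
  V v := K ⊗[k] 𝔙.V v
  map _ _ e := (𝔙.map e).baseChange K

/-- A subrepresentation. -/
structure SubRep (𝔙 : QuiverRep.{u, w} k Q) where
  /-- the subspace at a vertex -/
  space : ∀ v : Q, Submodule k (𝔙.V v)
  map_mem : ∀ ⦃u v : Q⦄ (e : u ⟶ v), ∀ x ∈ space u, 𝔙.map e x ∈ space v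

/-- A subrepresentation as a representation. -/
def SubRep.toRep {𝔙 : QuiverRep.{u, w} k Q} (𝔚 : 𝔙.SubRep) : QuiverRep.{u, w} k Q where
  V v := 𝔚.space v
  map _ _ e := (𝔙.map e).restrict (𝔚.map_mem e)

/-! ### The linked projective space

The linked projective space of `𝔙` is the `k`-scheme parameterizing the subrepresentations of pure
dimension one of `𝔙`, embedded in the product of the projective spaces of lines in the `𝔙.V v` for
`v` in a set `A` of vertices `1`-generating `𝔙`. We construct its underlying topological space. As
for every scheme, its points are the classes of its points with values in extension fields `K` of
`k`, two of these being equivalent if they have the same image; and its closed sets are cut out by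
multihomogeneous polynomials over `k` in the coordinates. Every residue field is finitely
generated over `k`, so fields in the universe of `k` suffice. -/

/-- A point of the linked projective space of `𝔙` with values in an extension field `K` of `k`:
a subrepresentation of pure dimension one of the base change of `𝔙` to `K`. -/
structure FieldPoint (𝔙 : QuiverRep.{u, w} k Q) where
  /-- the extension field -/
  K : Type u
  [field : Field K]
  [algebra : Algebra k K]
  /-- the subrepresentation -/
  sub : (𝔙.baseChange K).SubRep
  finrank_space : ∀ v : Q, Module.finrank K (sub.space v) = 1

attribute [instance] FieldPoint.field FieldPoint.algebra

/-- The polynomials over `k` in the coordinates on the spaces `𝔙.V v` for `v ∈ A`; the variables are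
the linear functionals on these spaces. -/
abbrev CoordPoly (𝔙 : QuiverRep.{u, w} k Q) (A : Set Q) :=
  MvPolynomial (Σ v : A, Module.Dual k (𝔙.V v)) k

/-- Multihomogeneity: for each `v ∈ A`, homogeneity in the coordinates on `𝔙.V v`. -/
def IsMultihomogeneous {𝔙 : QuiverRep.{u, w} k Q} {A : Set Q} (F : 𝔙.CoordPoly A) : Prop :=
  ∃ d : A →₀ ℕ, F.IsWeightedHomogeneous
    (fun x : (Σ v : A, Module.Dual k (𝔙.V v)) => Finsupp.single x.1 1) d

/-- The value of a polynomial at a tuple of vectors with coordinates in `K`. -/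
noncomputable def evalAt {𝔙 : QuiverRep.{u, w} k Q} {A : Set Q} {K : Type u} [Field K] [Algebra k K]
    (s : ∀ v : A, K ⊗[k] 𝔙.V v) (F : 𝔙.CoordPoly A) : K :=
  MvPolynomial.aeval
    (fun x : (Σ v : A, Module.Dual k (𝔙.V v)) => Module.Dual.baseChange K x.2 (s x.1)) F

/-- The nonvanishing locus of a polynomial (meant for multihomogeneous ones). -/
def nonvanishing {𝔙 : QuiverRep.{u, w} k Q} {A : Set Q} (F : 𝔙.CoordPoly A) :
    Set 𝔙.FieldPoint :=
  {P | ∃ s : ∀ v : A, P.K ⊗[k] 𝔙.V v, (∀ v : A, s v ∈ P.sub.space v) ∧ evalAt s F ≠ 0}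

/-- The Zariski topology on field-valued points, for the coordinates at the vertices of `A`. -/
abbrev zariski (𝔙 : QuiverRep.{u, w} k Q) (A : Set Q) : TopologicalSpace 𝔙.FieldPoint :=
  TopologicalSpace.generateFrom
    {U | ∃ F : 𝔙.CoordPoly A, IsMultihomogeneous F ∧ U = nonvanishing F}

/-- The underlying topological space of the linked projective space of `𝔙`: two field-valued points
are identified if the same multihomogeneous polynomials over `k` vanish at them. -/
def LP (𝔙 : QuiverRep.{u, w} k Q) (A : Set Q) :=
  @SeparationQuotient 𝔙.FieldPoint (𝔙.zariski A)

instance (𝔙 : QuiverRep.{u, w} k Q) (A : Set Q) : TopologicalSpace (𝔙.LP A) :=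
  @instTopologicalSpaceSeparationQuotient 𝔙.FieldPoint (𝔙.zariski A)

/-- The point of the linked projective space given by a field-valued point. -/
def FieldPoint.toLP {𝔙 : QuiverRep.{u, w} k Q} (A : Set Q) (P : 𝔙.FieldPoint) : 𝔙.LP A :=
  @SeparationQuotient.mk 𝔙.FieldPoint (𝔙.zariski A) P

/-- The set of points generated by the vertex `v`. -/
def LPgen (𝔙 : QuiverRep.{u, w} k Q) (A : Set Q) (v : Q) : Set (𝔙.LP A) :=
  {x | ∃ P : 𝔙.FieldPoint, P.toLP A = x ∧ P.sub.toRep.GeneratedBy {v}}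

/-- The closure of the set of points generated by the vertex `v`. -/
def LPvert (𝔙 : QuiverRep.{u, w} k Q) (A : Set Q) (v : Q) : Set (𝔙.LP A) :=
  closure (𝔙.LPgen A v)

/-- The intersection of the `LPvert v` for `v ∈ H`. -/
def LPinter (𝔙 : QuiverRep.{u, w} k Q) (A H : Set Q) : Set (𝔙.LP A) :=
  ⋂ v ∈ H, 𝔙.LPvert A v

/-- The stratum of `H`: the points in `LPvert v` for `v ∈ H` and for no other `v`. -/
def LPstratum (𝔙 : QuiverRep.{u, w} k Q) (A H : Set Q) : Set (𝔙.LP A) :=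
  𝔙.LPinter A H \ ⋃ v ∈ Hᶜ, 𝔙.LPvert A v

end QuiverRep

/-!
A point `P` of the linked projective space is a net of lines. For two vertices `x` and `y`, say that
`x` generates `y` if the map along some path from `x` to `y` does not vanish on the line of `P` at
`x`. Since the maps along non-admissible paths vanish, this is a partial order on the vertices. Call
its extremal vertices, those generated by no other, the sources of `P`. Outside a finite set of
vertices depending only on `𝔙`, every space is the image of another one under the map along an
arrow (`QuiverRep.exists_finite_generates`). Thus there are finitely many sources, every vertex is
generated by one of them, and a set of vertices `1`-generates `P` if and only if it contains the
sources (`QuiverRep.FieldPoint.minimallyOneGeneratedBy_iff`). Everything follows from two facts: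

* `P` lies in the closure of the set of points generated by `v` if and only if `v` is a source of
  `P` (`QuiverRep.FieldPoint.toLP_mem_LPvert_iff`);
* if `H` is a nonempty set of sources of `P`, then `P` is a limit of points whose set of sources
  is `H` (`QuiverRep.FieldPoint.mem_closure_sources_eq`).

In the first one, a vertex `z ≠ v` generating `v` in `P` also generates `v` in the nearby points,
where it cannot be generated by `v`; the converse is the second fact for `H = {v}`.

For the second fact, consider the types of the paths from a vertex `u` whose maps vanish on the line
at `u`. Since maps along disjoint paths are jointly injective, these types have a least one `e`
(`ZnQuiver.IsLineNet.exists_isLeast`). If `u` is a source, then so is the vertex where the paths of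
type `e` arrive (`ZnQuiver.IsLineNet.isSource_translate`), and every vertex not generated by `u` is
reached from `u` through this next source. Hence all sources are obtained from any of them by
passing repeatedly to the next one (`ZnQuiver.IsLineNet.exists_generates_of_stable`). So if `H` is
not the set of all sources, then there is a `p` in `H` whose next source `v` is not in `H`. The
vertices `p` and `v` are neighbors, and by exactness a generator of the line at `v` is the image of
some vector `b` at `p`. Replacing the generator `a` of the line at `p` by `a + τ b`, for a
transcendental `τ`, and the lines generated by `p` accordingly, yields a point that specializes to
`P` as `τ` tends to zero and whose sources are those of `P` except `v`
(`QuiverRep.FieldPoint.exists_merge`). The second fact follows by induction on the number of sources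
not in `H`.
-/

/-! ### Types of paths and translation of vertices -/

section Types

variable {n : ℕ}

theorem exists_eq_add_single {t : Fin (n + 1) → ℕ} {a : Fin (n + 1)} (ha : t a ≠ 0) :
    ∃ t' : Fin (n + 1) → ℕ, t = t' + Pi.single a 1 := by
  have hle : Pi.single a 1 ≤ t := by
    intro b
    rcases eq_or_ne b a with rfl | hb
    · simpa using Nat.one_le_iff_ne_zero.2 ha
    · simp [hb]
  exact ⟨t - Pi.single a 1, (tsub_add_cancel_of_le hle).symm⟩

/-- Induction on tuples of natural numbers, adding one unit vector at a time. -/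
theorem single_induction {p : (Fin (n + 1) → ℕ) → Prop} (zero : p 0)
    (add : ∀ t a, p t → p (t + Pi.single a 1)) (t : Fin (n + 1) → ℕ) : p t := by
  induction hs : ∑ a, t a generalizing t with
  | zero =>
    have : t = 0 := by
      funext a
      exact (Finset.sum_eq_zero_iff.1 hs) a (Finset.mem_univ a)
    exact this ▸ zero
  | succ s ih =>
    obtain ⟨a, ha⟩ : ∃ a, t a ≠ 0 := by
      by_contra! h0
      simp [h0] at hs
    obtain ⟨t', rfl⟩ := exists_eq_add_single ha
    refine add _ _ (ih t' ?_)
    simp only [Pi.add_apply, Finset.sum_add_distrib, Finset.sum_pi_single', Finset.mem_univ,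
      if_true] at hs
    omega

end Types

namespace ZnQuiver

variable {n : ℕ} {Q : Type q} [Quiver.{h} Q] (T : ZnQuiver n Q)

/-- The type of a path: the tuple of the numbers of its arrows of each type. -/
def type {u v : Q} (γ : Quiver.Path u v) : Fin (n + 1) → ℕ := fun a => pathType T.ty a γ

@[simp]
theorem type_nil (u : Q) : T.type (Quiver.Path.nil : Quiver.Path u u) = 0 := rfl

theorem type_cons {u v w : Q} (γ : Quiver.Path u v) (e : v ⟶ w) :
    T.type (γ.cons e) = T.type γ + Pi.single (T.ty e) 1 := by
  funext a
  simp [type, pathType, Pi.single_apply, eq_comm]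

theorem type_comp {u v w : Q} (γ : Quiver.Path u v) (δ : Quiver.Path v w) :
    T.type (γ.comp δ) = T.type γ + T.type δ := by
  induction δ with
  | nil => simp
  | cons δ e ih => rw [Quiver.Path.comp_cons, type_cons, type_cons, ih, add_assoc]

theorem exists_arrow (u : Q) (a : Fin (n + 1)) : ∃ (v : Q) (e : u ⟶ v), T.ty e = a := by
  obtain ⟨⟨v, e⟩, he, -⟩ := T.existsUnique_arrow u a
  exact ⟨v, e, he⟩

theorem exists_type_eq (u : Q) (t : Fin (n + 1) → ℕ) :
    ∃ (v : Q) (γ : Quiver.Path u v), T.type γ = t := by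
  induction t using single_induction with
  | zero => exact ⟨u, .nil, rfl⟩
  | add t a ih =>
    obtain ⟨v, γ, rfl⟩ := ih
    obtain ⟨w, e, rfl⟩ := T.exists_arrow v a
    exact ⟨w, γ.cons e, T.type_cons γ e⟩

/-- The vertex where the paths of type `t` leaving `u` arrive. -/
noncomputable def translate (u : Q) (t : Fin (n + 1) → ℕ) : Q := (T.exists_type_eq u t).choose

theorem exists_path (u : Q) (t : Fin (n + 1) → ℕ) :
    ∃ γ : Quiver.Path u (T.translate u t), T.type γ = t :=
  (T.exists_type_eq u t).choose_spec

theorem translate_eq_translate_iff {u : Q} {t s : Fin (n + 1) → ℕ} :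
    T.translate u t = T.translate u s ↔ ∃ c : ℤ, ∀ a, (t a : ℤ) - s a = c := by
  obtain ⟨γ, hγ⟩ := T.exists_path u t
  obtain ⟨δ, hδ⟩ := T.exists_path u s
  have h1 : ∀ a, pathType T.ty a γ = t a := congrFun hγ
  have h2 : ∀ a, pathType T.ty a δ = s a := congrFun hδ
  simp only [T.same_target_iff γ δ, h1, h2]

theorem translate_type {u v : Q} (γ : Quiver.Path u v) : T.translate u (T.type γ) = v := by
  obtain ⟨δ, hδ⟩ := T.exists_path u (T.type γ)
  refine (T.same_target_iff δ γ).2 ⟨0, fun a => ?_⟩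
  have := congrFun hδ a
  simp only [type] at this
  simp [this]

theorem exists_path_of_translate_eq {u v : Q} {t : Fin (n + 1) → ℕ} (ht : T.translate u t = v) :
    ∃ γ : Quiver.Path u v, T.type γ = t := by
  subst ht
  exact T.exists_path u t

@[simp]
theorem translate_zero (u : Q) : T.translate u 0 = u := T.translate_type Quiver.Path.nil

theorem translate_add (u : Q) (t s : Fin (n + 1) → ℕ) :
    T.translate u (t + s) = T.translate (T.translate u t) s := by
  obtain ⟨γ, hγ⟩ := T.exists_path u t
  obtain ⟨δ, hδ⟩ := T.exists_path (T.translate u t) s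
  rw [← T.translate_type (γ.comp δ), type_comp, hγ, hδ]

theorem translate_eq_self_iff {u : Q} {t : Fin (n + 1) → ℕ} :
    T.translate u t = u ↔ ∃ c, ∀ a, t a = c := by
  conv_lhs => rhs; rw [← T.translate_zero u]
  rw [translate_eq_translate_iff]
  constructor
  · rintro ⟨c, hc⟩
    refine ⟨c.toNat, fun a => ?_⟩
    have := hc a
    simp only [Pi.zero_apply, Nat.cast_zero, sub_zero] at this
    omega
  · rintro ⟨c, hc⟩
    exact ⟨c, fun a => by simp [hc a]⟩

theorem eq_zero_of_translate_eq_self {u : Q} {t : Fin (n + 1) → ℕ} (ht : T.translate u t = u)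
    (hadm : ∃ a, t a = 0) : t = 0 := by
  obtain ⟨c, hc⟩ := T.translate_eq_self_iff.1 ht
  obtain ⟨a, ha⟩ := hadm
  funext b
  rw [hc b, ← hc a, ha, Pi.zero_apply]

/-- Every translation is undone by a translation. -/
theorem exists_translate_translate (t : Fin (n + 1) → ℕ) :
    ∃ s, ∀ u, T.translate (T.translate u t) s = u ∧ T.translate (T.translate u s) t = u := by
  -- the complement of `t` in a large constant tuple
  refine ⟨fun a => (∑ b, t b) - t a, fun u => ?_⟩
  have hle : ∀ a, t a ≤ ∑ b, t b := fun a =>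
    Finset.single_le_sum (f := t) (fun _ _ => Nat.zero_le _) (Finset.mem_univ a)
  rw [← translate_add, ← translate_add, translate_eq_self_iff, translate_eq_self_iff]
  refine ⟨⟨∑ b, t b, fun a => ?_⟩, ⟨∑ b, t b, fun a => ?_⟩⟩ <;>
  · have := hle a
    simp only [Pi.add_apply]
    omega

theorem translate_left_injective (t : Fin (n + 1) → ℕ) {u v : Q}
    (huv : T.translate u t = T.translate v t) : u = v := by
  obtain ⟨s, hs⟩ := T.exists_translate_translate t
  rw [← (hs u).1, huv, (hs v).1]

theorem exists_translate_eq (u : Q) (t : Fin (n + 1) → ℕ) : ∃ v, T.translate v t = u := by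
  obtain ⟨s, hs⟩ := T.exists_translate_translate t
  exact ⟨_, (hs u).2⟩

theorem exists_admissible_translate_eq (u v : Q) :
    ∃ t, (∃ a, t a = 0) ∧ T.translate u t = v := by
  obtain ⟨γ, hγ⟩ := T.exists_admissible u v
  exact ⟨T.type γ, hγ, T.translate_type γ⟩

theorem translate_right_comm (u : Q) (t s : Fin (n + 1) → ℕ) :
    T.translate (T.translate u t) s = T.translate (T.translate u s) t := by
  rw [← translate_add, ← translate_add, add_comm]

/-! ### Nonvanishing of the maps on a subrepresentation of pure dimension one -/

/-- The combinatorics of a weakly linked net of lines with jointly injective maps: `G u t` stands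
for the nonvanishing, on the line at the vertex `u`, of the map along a path of type `t`. -/
structure IsLineNet (G : Q → (Fin (n + 1) → ℕ) → Prop) : Prop where
  zero : ∀ u, G u 0
  add_iff : ∀ {u t s}, G u (t + s) ↔ G u t ∧ G (T.translate u t) s
  admissible : ∀ {u t}, G u t → ∃ a, t a = 0
  disjoint : ∀ {u t s}, (∀ a, t a = 0 ∨ s a = 0) → G u t ∨ G u s

/-- The vertex `x` generates the vertex `y`: the map along some path from `x` to `y` does not
vanish. -/
def Generates (G : Q → (Fin (n + 1) → ℕ) → Prop) (x y : Q) : Prop :=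
  ∃ t, T.translate x t = y ∧ G x t

/-- A vertex generated by no other vertex. -/
def IsSource (G : Q → (Fin (n + 1) → ℕ) → Prop) (x : Q) : Prop :=
  ∀ z, T.Generates G z x → z = x

variable {T} in
theorem IsSource.mem_of_generates {G : Q → (Fin (n + 1) → ℕ) → Prop} {B : Set Q}
    (hgen : ∀ x, ∃ y ∈ B, T.Generates G y x) {x : Q}
    (hx : T.IsSource G x) : x ∈ B := by
  obtain ⟨y, hy, hyx⟩ := hgen x
  exact hx y hyx ▸ hy

namespace IsLineNet

variable {T} {G : Q → (Fin (n + 1) → ℕ) → Prop} (hG : T.IsLineNet G)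

include hG

theorem mono {u : Q} {t s : Fin (n + 1) → ℕ} (hts : t ≤ s) (hs : G u s) : G u t := by
  obtain ⟨r, rfl⟩ := exists_add_of_le hts
  exact (hG.add_iff.1 hs).1

theorem generates_refl (x : Q) : T.Generates G x x := ⟨0, T.translate_zero x, hG.zero x⟩

theorem generates_trans {x y z : Q} (hxy : T.Generates G x y) (hyz : T.Generates G y z) :
    T.Generates G x z := by
  obtain ⟨t, rfl, ht⟩ := hxy
  obtain ⟨s, rfl, hs⟩ := hyz
  exact ⟨t + s, T.translate_add x t s, hG.add_iff.2 ⟨ht, hs⟩⟩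

theorem generates_antisymm {x y : Q} (hxy : T.Generates G x y) (hyx : T.Generates G y x) :
    x = y := by
  obtain ⟨t, rfl, ht⟩ := hxy
  obtain ⟨s, hs, hs'⟩ := hyx
  rw [← T.translate_add] at hs
  have h0 := T.eq_zero_of_translate_eq_self hs (hG.admissible (hG.add_iff.2 ⟨ht, hs'⟩))
  have : t = 0 := by
    funext a
    have := congrFun h0 a
    simp only [Pi.add_apply, Pi.zero_apply] at this ⊢
    omega
  rw [this, T.translate_zero]

theorem eq_zero_of_isSource {z x : Q} {t : Fin (n + 1) → ℕ} (hx : T.IsSource G x)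
    (hz : T.translate z t = x) (ht : G z t) : t = 0 := by
  have := hx z ⟨t, hz, ht⟩
  subst this
  exact T.eq_zero_of_translate_eq_self hz (hG.admissible ht)

/-- The types of the vanishing maps from a vertex are stable under infima: past the infimum of two
types what remains of the two is disjoint. Hence there is a least such type. -/
theorem exists_isLeast (u : Q) : ∃ e, IsLeast {t | ¬ G u t} e := by
  obtain ⟨e, he, hmin⟩ := WellFounded.has_min (measure fun t : Fin (n + 1) → ℕ => ∑ a, t a).wf
    {t | ¬ G u t} ⟨1, fun h1 => by simpa using hG.admissible h1⟩
  refine ⟨e, he, fun t ht => ?_⟩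
  have hinf : ¬ G u (e ⊓ t) := by
    intro hm
    have h1 : e = e ⊓ t + (e - e ⊓ t) := (add_tsub_cancel_of_le inf_le_left).symm
    have h2 : t = e ⊓ t + (t - e ⊓ t) := (add_tsub_cancel_of_le inf_le_right).symm
    rcases hG.disjoint (u := T.translate u (e ⊓ t)) (t := e - e ⊓ t) (s := t - e ⊓ t)
      (fun a => by simp only [Pi.sub_apply, Pi.inf_apply]; omega) with h | h
    · exact he (h1 ▸ hG.add_iff.2 ⟨hm, h⟩)
    · exact ht (h2 ▸ hG.add_iff.2 ⟨hm, h⟩)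
  by_contra hle
  refine hmin _ hinf ?_
  change ∑ a, (e ⊓ t) a < ∑ a, e a
  refine Finset.sum_lt_sum (fun a _ => inf_le_left) ?_
  obtain ⟨a, ha⟩ : ∃ a, ¬ e a ≤ t a := by simpa [Pi.le_def] using hle
  exact ⟨a, Finset.mem_univ a, by simpa using ha⟩

theorem isLeast_le_one {u : Q} {e : Fin (n + 1) → ℕ} (he : IsLeast {t | ¬ G u t} e) : e ≤ 1 :=
  he.2 fun h1 => by simpa using hG.admissible h1

theorem isLeast_ne_zero {u : Q} {e : Fin (n + 1) → ℕ} (he : IsLeast {t | ¬ G u t} e) :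
    e ≠ 0 := by
  rintro rfl
  exact he.1 (hG.zero u)

/-- The vertex reached from a source `u` along the least type `e` whose map vanishes is a source.
Suppose it is generated along an arrow of type `a`. If `a` occurs in `e`, then composing this arrow
with the nonvanishing map along the rest of `e` shows that the map along `e` does not vanish.
Otherwise let `x` be the vertex from which an arrow of type `a` leads to `u`. The map along `e` does
not vanish from `x`, nor does its composition with the generating arrow. But this composition can
be taken to start with the arrow from `x` to `u`, whose map vanishes since `u` is a source. -/
theorem isSource_translate {u : Q} {e : Fin (n + 1) → ℕ} (hu : T.IsSource G u)
    (he : IsLeast {t | ¬ G u t} e) : T.IsSource G (T.translate u e) := by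
  rintro z ⟨t, hzt, ht⟩
  by_contra hne
  obtain ⟨a, ha⟩ : ∃ a, t a ≠ 0 := by
    by_contra! h0
    have : t = 0 := funext h0
    exact hne (by rw [← hzt, this, T.translate_zero])
  obtain ⟨t', rfl⟩ := exists_eq_add_single ha
  have hz := (hG.add_iff.1 ht).2
  rw [T.translate_add] at hzt
  rcases eq_or_ne (e a) 0 with hea | hea
  · obtain ⟨x, hx⟩ := T.exists_translate_eq u (Pi.single a 1)
    have hxa : ¬ G x (Pi.single a 1) := fun h => by
      simpa using congrFun (hG.eq_zero_of_isSource hu hx h) a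
    have hxe : G x e := by
      by_contra hxe
      obtain ⟨f, hf⟩ := hG.exists_isLeast x
      refine hG.isLeast_ne_zero hf (funext fun b => ?_)
      rcases eq_or_ne b a with rfl | hb
      · simpa [hea] using hf.2 hxe b
      · simpa [hb] using hf.2 hxa b
    have hxz : T.translate x e = T.translate z t' := by
      apply T.translate_left_injective (Pi.single a 1)
      rw [T.translate_right_comm, hx, hzt]
    refine hxa (hG.mono le_add_self (hG.add_iff.2 ⟨hxe, ?_⟩))
    rwa [hxz]
  · obtain ⟨e', rfl⟩ := exists_eq_add_single hea
    have huz : T.translate u e' = T.translate z t' := by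
      apply T.translate_left_injective (Pi.single a 1)
      rw [hzt, T.translate_add]
    refine he.1 (hG.add_iff.2 ⟨?_, by rwa [huz]⟩)
    by_contra hue
    simpa using he.2 hue a

/-- Two vertices generating the same vertex are generated by a common one. -/
theorem exists_generates_of_generates {x y z : Q} (hyx : T.Generates G y x)
    (hzx : T.Generates G z x) : ∃ w, T.Generates G w y ∧ T.Generates G w z := by
  obtain ⟨t, hyt, ht⟩ := hyx
  obtain ⟨s, hzs, hs⟩ := hzx
  -- cancel the common part of the two types, then complete the square
  have h1 : t = (t - t ⊓ s) + t ⊓ s := (tsub_add_cancel_of_le inf_le_left).symm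
  have h2 : s = (s - t ⊓ s) + t ⊓ s := (tsub_add_cancel_of_le inf_le_right).symm
  have ht' : G y (t - t ⊓ s) := hG.mono tsub_le_self ht
  have hs' : G z (s - t ⊓ s) := hG.mono tsub_le_self hs
  have hdisj : ∀ a, (t - t ⊓ s) a = 0 ∨ (s - t ⊓ s) a = 0 := fun a => by
    simp only [Pi.sub_apply, Pi.inf_apply]; omega
  have heq : T.translate y (t - t ⊓ s) = T.translate z (s - t ⊓ s) := by
    apply T.translate_left_injective (t ⊓ s)
    rw [← T.translate_add, ← T.translate_add, ← h1, ← h2, hyt, hzs]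
  generalize t - t ⊓ s = t' at *
  generalize s - t ⊓ s = s' at *
  obtain ⟨w, hw⟩ := T.exists_translate_eq y s'
  have hw' : T.translate w t' = z := by
    apply T.translate_left_injective s'
    rw [T.translate_right_comm, hw, heq]
  have hws : G w (s' + t') := by
    rcases hG.disjoint (u := w) hdisj with h | h
    · rw [add_comm]
      exact hG.add_iff.2 ⟨h, by rwa [hw']⟩
    · exact hG.add_iff.2 ⟨h, by rwa [hw]⟩
  exact ⟨w, ⟨s', hw, hG.mono le_self_add hws⟩, ⟨t', hw', hG.mono le_add_self hws⟩⟩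

theorem isSource_unique {x y z : Q} (hy : T.IsSource G y) (hz : T.IsSource G z)
    (hyx : T.Generates G y x) (hzx : T.Generates G z x) : y = z := by
  obtain ⟨w, hwy, hwz⟩ := hG.exists_generates_of_generates hyx hzx
  rw [← hy w hwy, hz w hwz]

/-- A nonempty set stable under passing to the vertex at the end of the least vanishing type
generates all vertices: a vanishing map factors through that vertex. -/
theorem exists_generates_of_stable {S : Set Q} (hne : S.Nonempty)
    (hS : ∀ p ∈ S, ∀ e, IsLeast {t | ¬ G p t} e → T.translate p e ∈ S) (x : Q) :
    ∃ y ∈ S, T.Generates G y x := by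
  obtain ⟨p, hp⟩ := hne
  obtain ⟨t, -, ht⟩ := T.exists_admissible_translate_eq p x
  induction hs : ∑ a, t a using Nat.strong_induction_on generalizing p t with
  | _ s ih =>
    by_cases hpt : G p t
    · exact ⟨p, hp, t, ht, hpt⟩
    obtain ⟨e, he⟩ := hG.exists_isLeast p
    obtain ⟨r, rfl⟩ := exists_add_of_le (he.2 hpt)
    obtain ⟨a, ha⟩ := Function.ne_iff.1 (hG.isLeast_ne_zero he)
    refine ih (∑ a, r a) ?_ _ (hS p hp e he) r (by rw [← ht, T.translate_add]) rfl
    rw [← hs]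
    refine Finset.sum_lt_sum (fun a _ => by simp) ⟨a, Finset.mem_univ a, ?_⟩
    simpa using Nat.pos_of_ne_zero ha

theorem exists_isSource_generates {B : Set Q} (hB : B.Finite)
    (hgen : ∀ x, ∃ y ∈ B, T.Generates G y x) (x : Q) :
    ∃ y, T.IsSource G y ∧ T.Generates G y x := by
  let _ : PartialOrder Q :=
    { le := fun x y => T.Generates G y x
      le_refl := hG.generates_refl
      le_trans := fun _ _ _ h1 h2 => hG.generates_trans h2 h1
      le_antisymm := fun _ _ h1 h2 => hG.generates_antisymm h2 h1 }
  obtain ⟨b, hb, hbx⟩ := hgen x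
  obtain ⟨y, hby, hy⟩ := hB.exists_le_maximal hb
  refine ⟨y, fun z hz => ?_, hG.generates_trans hby hbx⟩
  obtain ⟨c, hc, hcz⟩ := hgen z
  have hcy : T.Generates G c y := hG.generates_trans hcz hz
  have hyc : T.Generates G y c := hy.2 hc hcy
  exact hG.generates_antisymm hz (hG.generates_trans hyc hcz)

end IsLineNet

/-! ### The hull of a finite set of vertices -/

/-- The hull of a set `H` of vertices: the vertices that can be reached from `H` avoiding any given
arrow type. -/
def hull (H : Set Q) : Set Q := {x | ∀ a, ∃ u ∈ H, ∃ t, t a = 0 ∧ T.translate u t = x}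

theorem hull_finite {H : Set Q} (hH : H.Finite) : (T.hull H).Finite := by
  rcases H.eq_empty_or_nonempty with rfl | ⟨o, ho⟩
  · convert Set.finite_empty
    ext x
    simp [hull]
  choose r _ hr using T.exists_admissible_translate_eq o
  refine ((Set.finite_Icc 0 (∑ u ∈ hH.toFinset, r u)).image (T.translate o)).subset ?_
  intro x hx
  obtain ⟨t, ⟨b, hb⟩, ht⟩ := T.exists_admissible_translate_eq o x
  refine ⟨t, ⟨zero_le, fun a => ?_⟩, ht⟩
  obtain ⟨v, hv, s, hsa, hs⟩ := hx a
  have hle : r v a ≤ (∑ u ∈ hH.toFinset, r u) a := by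
    rw [Finset.sum_apply]
    exact Finset.single_le_sum (f := fun u => r u a) (fun _ _ => Nat.zero_le _)
      (hH.mem_toFinset.2 hv)
  refine le_trans (show t a ≤ r v a from ?_) hle
  obtain ⟨c, hc⟩ := T.translate_eq_translate_iff (u := o) (t := r v + s) (s := t) |>.1
    (by rw [T.translate_add, hr, hs, ht])
  have h1 := hc a
  have h2 := hc b
  simp only [Pi.add_apply, hsa, hb, Nat.cast_add, Nat.cast_zero] at h1 h2
  omega

/-- The hull generates all vertices if any vertex that can be reached from `H` only by paths with
an arrow of type `a` is generated along this arrow. -/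
theorem exists_mem_hull_generates {G : Q → (Fin (n + 1) → ℕ) → Prop} (hG : T.IsLineNet G)
    {H : Set Q} (hne : H.Nonempty)
    (hH : ∀ y a, (∀ u ∈ H, ∀ t, T.translate u t = T.translate y (Pi.single a 1) → t a ≠ 0) →
      G y (Pi.single a 1)) (x : Q) : ∃ y ∈ T.hull H, T.Generates G y x := by
  obtain ⟨o, ho⟩ := hne
  obtain ⟨t, -, ht⟩ := T.exists_admissible_translate_eq o x
  induction hs : ∑ a, t a generalizing t x with
  | zero =>
    have : t = 0 := by
      funext a
      exact (Finset.sum_eq_zero_iff.1 hs) a (Finset.mem_univ a)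
    subst this
    rw [T.translate_zero] at ht
    subst ht
    exact ⟨o, fun a => ⟨o, ho, 0, rfl, T.translate_zero o⟩, hG.generates_refl o⟩
  | succ s ih =>
    by_cases hx : x ∈ T.hull H
    · exact ⟨x, hx, hG.generates_refl x⟩
    obtain ⟨a, ha⟩ : ∃ a, ∀ u ∈ H, ∀ t, t a = 0 → ¬ T.translate u t = x := by
      simpa [hull] using hx
    obtain ⟨t', rfl⟩ := exists_eq_add_single (fun h0 => ha o ho t h0 ht)
    rw [T.translate_add] at ht
    obtain ⟨y, hy, hyt⟩ := ih (T.translate o t') t' rfl (by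
      simp only [Pi.add_apply, Finset.sum_add_distrib, Finset.sum_pi_single', Finset.mem_univ,
        if_true] at hs
      omega)
    refine ⟨y, hy, hG.generates_trans hyt ⟨Pi.single a 1, ht, hH _ _ fun u hu r hr h0 => ?_⟩⟩
    exact ha u hu r h0 (hr.trans ht)

end ZnQuiver

/-! ### Base change of linear maps -/

section BaseChange

variable {k : Type*} [Field k] (K : Type*) [Field K] [Algebra k K] {V V₁ V₂ : Type*}
  [AddCommGroup V] [Module k V] [AddCommGroup V₁] [Module k V₁] [AddCommGroup V₂] [Module k V₂]

theorem LinearMap.baseChange_smul_algebraMap (c : k) (f : V →ₗ[k] V₁) :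
    (c • f).baseChange K = algebraMap k K c • f.baseChange K := by
  rw [LinearMap.baseChange_smul, algebraMap_smul]

theorem LinearMap.eq_zero_of_baseChange_eq_zero {f : V →ₗ[k] V₁} {g : V →ₗ[k] V₂}
    (h : LinearMap.ker f ⊓ LinearMap.ker g = ⊥) {x : K ⊗[k] V} (hf : f.baseChange K x = 0)
    (hg : g.baseChange K x = 0) : x = 0 := by
  -- a left inverse of the pair of maps survives base change
  obtain ⟨r, hr⟩ := LinearMap.exists_leftInverse_of_injective (f.prod g)
    (by rw [LinearMap.ker_prod, h])
  have hid : (r ∘ₗ LinearMap.inl k _ _) ∘ₗ f + (r ∘ₗ LinearMap.inr k _ _) ∘ₗ g =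
      LinearMap.id := by
    rw [← hr]
    ext x
    simp [← map_add]
  generalize r ∘ₗ LinearMap.inl k _ _ = r₁ at hid
  generalize r ∘ₗ LinearMap.inr k _ _ = r₂ at hid
  have := congrArg (fun f => LinearMap.baseChange K f x) hid
  rw [LinearMap.baseChange_add, LinearMap.add_apply, LinearMap.baseChange_comp f,
    LinearMap.baseChange_comp g, LinearMap.comp_apply, LinearMap.comp_apply, hf, hg, map_zero,
    map_zero, add_zero, LinearMap.baseChange_id] at this
  exact this.symm

variable {K} in
/-- Linear functionals over the ground field separate the vectors of a base change. -/
theorem exists_dual_baseChange_ne_zero {x : K ⊗[k] V} (hx : x ≠ 0) :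
    ∃ l : Module.Dual k V, Module.Dual.baseChange K l x ≠ 0 := by
  let b := Module.Free.chooseBasis k V
  obtain ⟨i, hi⟩ : ∃ i, (b.baseChange K).repr x i ≠ 0 := by
    by_contra! h0
    exact hx ((b.baseChange K).repr.map_eq_zero_iff.1 (Finsupp.ext h0))
  refine ⟨b.coord i, ?_⟩
  convert hi
  clear hx hi
  induction x using TensorProduct.induction_on with
  | zero => simp
  | tmul c v => simp [Algebra.smul_def, mul_comm]
  | add x y hx hy => simp [hx, hy]

end BaseChange

/-! ### Maps along paths -/

namespace QuiverRep

section Paths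

variable {k : Type u} [Field k] {Q : Type q} [Quiver.{h} Q] {n : ℕ} {T : ZnQuiver n Q}
  {𝔙 : QuiverRep.{u, w} k Q}

theorem pathMap_comp {u v w : Q} (γ : Quiver.Path u v) (δ : Quiver.Path v w) :
    𝔙.pathMap (γ.comp δ) = 𝔙.pathMap δ ∘ₗ 𝔙.pathMap γ := by
  induction δ with
  | nil => rfl
  | cons δ e ih => rw [Quiver.Path.comp_cons, pathMap, pathMap, ih, LinearMap.comp_assoc]

theorem pathMap_comp_apply {u v w : Q} (γ : Quiver.Path u v) (δ : Quiver.Path v w)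
    (x : 𝔙.V u) : 𝔙.pathMap (γ.comp δ) x = 𝔙.pathMap δ (𝔙.pathMap γ x) := by
  rw [pathMap_comp, LinearMap.comp_apply]

/-- The maps along all non-admissible paths vanish: the first arrow making a path non-admissible
can be taken to complete a minimal circuit. -/
theorem IsWeaklyLinkedNet.pathMap_eq_zero (h𝔙 : 𝔙.IsWeaklyLinkedNet T) {u v : Q}
    (γ : Quiver.Path u v) (hγ : ¬ IsAdmissible T.ty γ) : 𝔙.pathMap γ = 0 := by
  induction γ with
  | nil => exact absurd ⟨0, rfl⟩ hγ
  | @cons y z α e ih =>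
    by_cases hα : IsAdmissible T.ty α
    swap
    · rw [pathMap, ih hα, LinearMap.comp_zero]
    have hne : ∀ b, T.type (α.cons e) b ≠ 0 := fun b hb => hγ ⟨b, hb⟩
    rw [T.type_cons] at hne
    -- the type of a minimal circuit, without its last arrow
    let m : Fin (n + 1) → ℕ := fun b => if b = T.ty e then 0 else 1
    have hm : m ≤ T.type α := by
      intro b
      by_cases hb : b = T.ty e
      · simp [m, hb]
      · have := hne b
        simp only [Pi.add_apply, Pi.single_apply, hb, if_false, add_zero] at this
        simpa [m, hb] using Nat.one_le_iff_ne_zero.2 this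
    obtain ⟨t, ht⟩ := exists_add_of_le hm
    obtain ⟨β, hβ⟩ := T.exists_path u t
    have hend : T.translate (T.translate u t) m = y := by
      rw [← T.translate_add, add_comm, ← ht]
      exact T.translate_type α
    obtain ⟨δ, hδ⟩ := T.exists_path_of_translate_eq hend
    have hadm : IsAdmissible T.ty (β.comp δ) := by
      obtain ⟨a, ha⟩ := hα
      refine ⟨a, ?_⟩
      change T.type (β.comp δ) a = 0
      rw [T.type_comp, hβ, hδ, add_comm, ← ht]
      exact ha
    obtain ⟨c, hc⟩ := h𝔙.smul_admissible α (β.comp δ) hadm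
    have hδe : T.type (δ.cons e) = 1 := by
      rw [T.type_cons, hδ]
      funext b
      by_cases hb : b = T.ty e <;> simp [m, hb]
    have h0 : 𝔙.pathMap (δ.cons e) = 0 := by
      refine h𝔙.minimal_circuit _ (fun a => (congrFun hδe a).le) ?_
      rintro ⟨a, ha⟩
      exact one_ne_zero ((congrFun hδe a).symm.trans ha)
    rw [pathMap] at h0 ⊢
    rw [hc, pathMap_comp, LinearMap.comp_smul, ← LinearMap.comp_assoc, h0, LinearMap.zero_comp,
      smul_zero]

theorem IsWeaklyLinkedNet.exists_pathMap_eq_smul (h𝔙 : 𝔙.IsWeaklyLinkedNet T) {u v : Q}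
    (γ δ : Quiver.Path u v) (h : T.type γ = T.type δ) :
    ∃ c : k, 𝔙.pathMap γ = c • 𝔙.pathMap δ := by
  by_cases hδ : IsAdmissible T.ty δ
  · exact h𝔙.smul_admissible γ δ hδ
  · refine ⟨0, ?_⟩
    rw [zero_smul]
    refine h𝔙.pathMap_eq_zero γ fun ⟨a, ha⟩ => hδ ⟨a, ?_⟩
    exact (congrFun h a).symm.trans ha

/-! ### Base change to an extension field -/

variable (K : Type u) [Field K] [Algebra k K]

theorem pathMap_baseChange {u v : Q} (γ : Quiver.Path u v) :
    (𝔙.baseChange K).pathMap γ = (𝔙.pathMap γ).baseChange K := by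
  induction γ with
  | nil => exact LinearMap.baseChange_id.symm
  | cons γ e ih =>
    rw [pathMap, pathMap, ih, LinearMap.baseChange_comp]
    rfl

theorem IsLinkedNet.baseChange (h𝔙 : 𝔙.IsLinkedNet T) : (𝔙.baseChange K).IsLinkedNet T where
  smul_admissible γ₁ γ₂ h := by
    obtain ⟨c, hc⟩ := h𝔙.smul_admissible γ₁ γ₂ h
    refine ⟨algebraMap k K c, ?_⟩
    rw [pathMap_baseChange, pathMap_baseChange, hc]
    exact LinearMap.baseChange_smul_algebraMap K c _
  minimal_circuit γ h1 h2 := by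
    rw [pathMap_baseChange, h𝔙.minimal_circuit γ h1 h2]
    exact LinearMap.baseChange_zero
  ker_inf_ker γ₁ γ₂ h1 h2 h := by
    rw [eq_bot_iff, pathMap_baseChange, pathMap_baseChange]
    rintro x ⟨hx1, hx2⟩
    exact LinearMap.eq_zero_of_baseChange_eq_zero K (h𝔙.ker_inf_ker γ₁ γ₂ h1 h2 h) hx1 hx2

theorem IsExact.baseChange (h𝔙 : 𝔙.IsExact T) : (𝔙.baseChange K).IsExact T := by
  intro u v huv γ δ hγ hδ
  have hex : Function.Exact (𝔙.pathMap γ) (𝔙.pathMap δ) :=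
    LinearMap.exact_iff.2 (h𝔙 u v huv γ δ hγ hδ).symm
  have := Module.Flat.lTensor_exact K hex
  rw [pathMap_baseChange, pathMap_baseChange]
  ext x
  exact (this x).symm

end Paths

end QuiverRep

/-! ### The line net of a point -/

namespace QuiverRep

variable {k : Type u} [Field k] {Q : Type q} [Quiver.{h} Q] {n : ℕ} {T : ZnQuiver n Q}
  {𝔙 : QuiverRep.{u, w} k Q}

theorem SubRep.pathMap_mem (𝔚 : 𝔙.SubRep) {u v : Q} (γ : Quiver.Path u v) {x : 𝔙.V u}
    (hx : x ∈ 𝔚.space u) : 𝔙.pathMap γ x ∈ 𝔚.space v := by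
  induction γ with
  | nil => exact hx
  | cons γ e ih => exact 𝔚.map_mem e _ ih

theorem SubRep.coe_toRep_pathMap (𝔚 : 𝔙.SubRep) {u v : Q} (γ : Quiver.Path u v)
    (x : 𝔚.space u) : Subtype.val (p := (· ∈ 𝔚.space v)) (𝔚.toRep.pathMap γ x) = 𝔙.pathMap γ x := by
  induction γ with
  | nil => rfl
  | cons γ e ih => exact congrArg (𝔙.map e) ih

namespace FieldPoint

theorem exists_vec (P : 𝔙.FieldPoint) (v : Q) :
    ∃ x ∈ P.sub.space v, x ≠ 0 ∧ ∀ y ∈ P.sub.space v, ∃ c : P.K, y = c • x := by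
  obtain ⟨⟨x, hx⟩, hx0, hspan⟩ := finrank_eq_one_iff'.1 (P.finrank_space v)
  refine ⟨x, hx, fun h => hx0 (Subtype.ext h), fun y hy => ?_⟩
  obtain ⟨c, hc⟩ := hspan ⟨y, hy⟩
  exact ⟨c, congrArg Subtype.val hc.symm⟩

/-- A generator of the line at a vertex. -/
noncomputable def vec (P : 𝔙.FieldPoint) (v : Q) : (𝔙.baseChange P.K).V v :=
  (P.exists_vec v).choose

theorem vec_mem (P : 𝔙.FieldPoint) (v : Q) : P.vec v ∈ P.sub.space v :=
  (P.exists_vec v).choose_spec.1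

theorem vec_ne_zero (P : 𝔙.FieldPoint) (v : Q) : P.vec v ≠ 0 :=
  (P.exists_vec v).choose_spec.2.1

theorem exists_eq_smul_vec (P : 𝔙.FieldPoint) {v : Q} {y : (𝔙.baseChange P.K).V v}
    (hy : y ∈ P.sub.space v) : ∃ c : P.K, y = c • P.vec v :=
  (P.exists_vec v).choose_spec.2.2 y hy

theorem exists_eq_smul (P : 𝔙.FieldPoint) {v : Q} {x y : (𝔙.baseChange P.K).V v}
    (hx : x ∈ P.sub.space v) (hx0 : x ≠ 0) (hy : y ∈ P.sub.space v) : ∃ c : P.K, y = c • x := by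
  obtain ⟨a, rfl⟩ := P.exists_eq_smul_vec hx
  obtain ⟨b, rfl⟩ := P.exists_eq_smul_vec hy
  have ha : a ≠ 0 := fun h => hx0 (by rw [h, zero_smul])
  exact ⟨b * a⁻¹, by rw [smul_smul, inv_mul_cancel_right₀ ha]⟩

/-- The map along some path of type `t` does not vanish on the line at `u`. -/
def Along (P : 𝔙.FieldPoint) (T : ZnQuiver n Q) (u : Q) (t : Fin (n + 1) → ℕ) : Prop :=
  ∃ (v : Q) (γ : Quiver.Path u v), T.type γ = t ∧ (𝔙.baseChange P.K).pathMap γ (P.vec u) ≠ 0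

variable {P : 𝔙.FieldPoint}

theorem along_of_ne_zero {u v : Q} (γ : Quiver.Path u v) {x : (𝔙.baseChange P.K).V u}
    (hx : x ∈ P.sub.space u) (h : (𝔙.baseChange P.K).pathMap γ x ≠ 0) :
    P.Along T u (T.type γ) := by
  refine ⟨v, γ, rfl, fun h0 => h ?_⟩
  obtain ⟨c, rfl⟩ := P.exists_eq_smul_vec hx
  rw [map_smul, h0, smul_zero]

theorem along_type_iff (h𝔙 : 𝔙.IsLinkedNet T) {u v : Q} (γ : Quiver.Path u v) :
    P.Along T u (T.type γ) ↔ (𝔙.baseChange P.K).pathMap γ (P.vec u) ≠ 0 := by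
  refine ⟨?_, along_of_ne_zero γ (P.vec_mem u)⟩
  rintro ⟨v', δ, hδ, hne⟩ h0
  obtain rfl : v' = v := by rw [← T.translate_type δ, hδ, T.translate_type]
  obtain ⟨c, hc⟩ := (h𝔙.baseChange P.K).exists_pathMap_eq_smul δ γ hδ
  exact hne (by rw [hc, LinearMap.smul_apply, h0, smul_zero])

theorem isLineNet (P : 𝔙.FieldPoint) (h𝔙 : 𝔙.IsLinkedNet T) : T.IsLineNet (P.Along T) where
  zero u := (along_type_iff h𝔙 (.nil : Quiver.Path u u)).2 (P.vec_ne_zero u)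
  add_iff {u t s} := by
    obtain ⟨γ, hγ⟩ := T.exists_path u t
    obtain ⟨δ, hδ⟩ := T.exists_path (T.translate u t) s
    have h1 := along_type_iff (P := P) h𝔙 (γ.comp δ)
    have h2 := along_type_iff (P := P) h𝔙 γ
    have h3 := along_type_iff (P := P) h𝔙 δ
    rw [T.type_comp, pathMap_comp_apply] at h1
    rw [hγ] at h1 h2
    rw [hδ] at h1 h3
    rw [h1, h2, h3]
    obtain ⟨c, hc⟩ := P.exists_eq_smul_vec (P.sub.pathMap_mem γ (P.vec_mem u))
    rw [hc, map_smul, smul_ne_zero_iff, smul_ne_zero_iff]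
    simp only [P.vec_ne_zero, ne_eq, not_false_eq_true, and_true]
  admissible {u t} := by
    rintro ⟨v, γ, rfl, hne⟩
    by_contra hγ
    refine hne ?_
    rw [(h𝔙.baseChange P.K).pathMap_eq_zero γ hγ, LinearMap.zero_apply]
  disjoint {u t s} hts := by
    obtain ⟨γ, hγ⟩ := T.exists_path u t
    obtain ⟨δ, hδ⟩ := T.exists_path u s
    by_contra! hcon
    have h1 := along_type_iff (P := P) h𝔙 γ
    have h2 := along_type_iff (P := P) h𝔙 δ
    rw [hγ] at h1
    rw [hδ] at h2
    rw [h1, h2, not_not, not_not] at hcon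
    -- if one of the two types is not admissible, then the other is zero
    have key : ∀ {v : Q} (α : Quiver.Path u v), T.type α = 0 →
        (𝔙.baseChange P.K).pathMap α (P.vec u) ≠ 0 := fun α hα => by
      rw [← along_type_iff h𝔙 α, hα]
      exact (along_type_iff h𝔙 (.nil : Quiver.Path u u)).2 (P.vec_ne_zero u)
    have hγadm : IsAdmissible T.ty γ := by
      by_contra hadm
      refine key δ (hδ.trans (funext fun a => (hts a).resolve_left fun ha => hadm ⟨a, ?_⟩)) hcon.2
      exact (congrFun hγ a).trans ha
    have hδadm : IsAdmissible T.ty δ := by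
      by_contra hadm
      refine key γ (hγ.trans (funext fun a => (hts a).resolve_right fun ha => hadm ⟨a, ?_⟩)) hcon.1
      exact (congrFun hδ a).trans ha
    have hker := (h𝔙.baseChange P.K).ker_inf_ker γ δ hγadm hδadm fun a => by
      have := hts a
      rw [← hγ, ← hδ] at this
      exact this
    exact P.vec_ne_zero u ((Submodule.mem_bot P.K).1 (hker ▸ ⟨hcon.1, hcon.2⟩))

theorem generates_iff (h𝔙 : 𝔙.IsLinkedNet T) {x y : Q} :
    T.Generates (P.Along T) x y ↔
      ∃ γ : Quiver.Path x y, (𝔙.baseChange P.K).pathMap γ (P.vec x) ≠ 0 := by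
  constructor
  · rintro ⟨t, hy, ht⟩
    obtain ⟨γ, rfl⟩ := T.exists_path_of_translate_eq hy
    exact ⟨γ, (along_type_iff h𝔙 γ).1 ht⟩
  · rintro ⟨γ, hγ⟩
    exact ⟨T.type γ, T.translate_type γ, (along_type_iff h𝔙 γ).2 hγ⟩

/-- The sources of the line net of a point; these are its unavoidable generators. -/
def sources (P : 𝔙.FieldPoint) (T : ZnQuiver n Q) : Set Q := {v | T.IsSource (P.Along T) v}

theorem surjective_toRep_pathMap_iff {x y : Q} (γ : Quiver.Path x y) :
    Function.Surjective (P.sub.toRep.pathMap γ) ↔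
      (𝔙.baseChange P.K).pathMap γ (P.vec x) ≠ 0 := by
  constructor
  · intro hsurj h0
    obtain ⟨⟨z, hz⟩, hzy⟩ := hsurj ⟨P.vec y, P.vec_mem y⟩
    obtain ⟨c, rfl⟩ := P.exists_eq_smul_vec hz
    have := P.sub.coe_toRep_pathMap γ ⟨_, hz⟩
    rw [hzy, map_smul, h0, smul_zero] at this
    exact P.vec_ne_zero y this
  · rintro hne ⟨z, hz⟩
    obtain ⟨c, rfl⟩ := P.exists_eq_smul (P.sub.pathMap_mem γ (P.vec_mem x)) hne hz
    refine ⟨⟨c • P.vec x, Submodule.smul_mem _ _ (P.vec_mem x)⟩, Subtype.ext ?_⟩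
    rw [P.sub.coe_toRep_pathMap γ, map_smul]

theorem oneGeneratedBy_iff (h𝔙 : 𝔙.IsLinkedNet T) {H : Set Q} :
    P.sub.toRep.OneGeneratedBy H ↔ ∀ y, ∃ x ∈ H, T.Generates (P.Along T) x y := by
  simp only [OneGeneratedBy, generates_iff h𝔙]
  exact forall_congr' fun y => exists_congr fun x => and_congr_right fun _ =>
    exists_congr fun γ => P.surjective_toRep_pathMap_iff γ

theorem generatedBy_singleton_iff (h𝔙 : 𝔙.IsLinkedNet T) {x : Q} :
    P.sub.toRep.GeneratedBy {x} ↔ ∀ y, T.Generates (P.Along T) x y := by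
  simp only [GeneratedBy, generates_iff h𝔙]
  refine forall_congr' fun y => ⟨fun htop => ?_, ?_⟩
  · by_contra! h0
    have hbot : (⨆ (u : Q) (_ : u ∈ ({x} : Set Q)) (γ : Quiver.Path u y),
        LinearMap.range (P.sub.toRep.pathMap γ)) ≤ ⊥ := by
      refine iSup_le fun u => iSup_le fun hu => iSup_le fun γ => ?_
      obtain rfl := Set.mem_singleton_iff.1 hu
      rintro _ ⟨⟨z, hz⟩, rfl⟩
      obtain ⟨c, rfl⟩ := P.exists_eq_smul_vec hz
      refine (Submodule.mem_bot _).2 (Subtype.ext ?_)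
      refine (P.sub.coe_toRep_pathMap γ ⟨_, hz⟩).trans ?_
      rw [map_smul, h0, smul_zero]
      rfl
    rw [htop] at hbot
    let z : P.sub.toRep.V y := ⟨P.vec y, P.vec_mem y⟩
    have hz : z = 0 := (Submodule.mem_bot _).1 (hbot (Submodule.mem_top (x := z)))
    exact P.vec_ne_zero y (congrArg Subtype.val hz)
  · rintro ⟨γ, hγ⟩
    rw [eq_top_iff, ← LinearMap.range_eq_top.2 ((P.surjective_toRep_pathMap_iff γ).2 hγ)]
    exact le_iSup_of_le x (le_iSup_of_le rfl (le_iSup_of_le γ le_rfl))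

end FieldPoint

/-! ### Finitely many vertices generate all points -/

/-- If all paths from `H` to the target of an arrow contain an arrow of its type, then they can be
taken through this arrow, whence its map is surjective. -/
theorem map_surjective_of_generatedBy (h𝔙 : 𝔙.IsLinkedNet T) {H : Set Q}
    (hH : 𝔙.GeneratedBy H) {x y : Q} (e : x ⟶ y)
    (he : ∀ u ∈ H, ∀ t, T.translate u t = y → t (T.ty e) ≠ 0) :
    Function.Surjective (𝔙.map e) := by
  rw [← LinearMap.range_eq_top, eq_top_iff, ← hH y]
  refine iSup_le fun u => iSup_le fun hu => iSup_le fun γ => ?_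
  obtain ⟨t, ht⟩ := exists_eq_add_single (he u hu _ (T.translate_type γ))
  have hx : T.translate u t = x := by
    apply T.translate_left_injective (Pi.single (T.ty e) 1)
    rw [← T.translate_add, ← ht, T.translate_type, ← zero_add (Pi.single (T.ty e) 1),
      ← T.type_nil x, ← T.type_cons, T.translate_type]
  obtain ⟨δ, hδ⟩ := T.exists_path_of_translate_eq hx
  obtain ⟨c, hc⟩ := h𝔙.exists_pathMap_eq_smul γ (δ.cons e) (by rw [T.type_cons, ht, hδ])
  rw [hc]
  rintro _ ⟨z, rfl⟩
  exact Submodule.smul_mem _ c ⟨𝔙.pathMap δ z, rfl⟩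

theorem exists_finite_generates (h𝔙 : 𝔙.IsLinkedNet T) (hpure : 𝔙.IsPure)
    (hnontrivial : 𝔙.IsNontrivial) (hfg : 𝔙.FinitelyGenerated) :
    ∃ B : Set Q, B.Finite ∧
      ∀ (P : 𝔙.FieldPoint) (x : Q), ∃ y ∈ B, T.Generates (P.Along T) y x := by
  obtain ⟨H, hfin, hgen⟩ := hfg
  have hne : H.Nonempty := by
    by_contra hH
    obtain ⟨v, hv⟩ := hnontrivial
    have := hgen v
    rw [Set.not_nonempty_iff_eq_empty.1 hH] at this
    simp only [Set.mem_empty_iff_false, iSup_false, iSup_bot] at this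
    exact bot_ne_top this
  refine ⟨T.hull H, T.hull_finite hfin, fun P =>
    T.exists_mem_hull_generates (P.isLineNet h𝔙) hne fun y a hya => ?_⟩
  obtain ⟨z, e, rfl⟩ := T.exists_arrow y a
  have htype : T.type (Quiver.Hom.toPath e) = Pi.single (T.ty e) 1 := by
    rw [Quiver.Hom.toPath, T.type_cons, T.type_nil, zero_add]
  rw [← htype, T.translate_type] at hya
  rw [← htype, FieldPoint.along_type_iff h𝔙]
  have hinj := (hpure _ _ _ (map_surjective_of_generatedBy h𝔙 hgen e hya)).1
  have hinj' : Function.Injective ((𝔙.map e).baseChange P.K) :=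
    Module.Flat.lTensor_preserves_injective_linearMap (M := P.K) _ hinj
  exact fun h0 => P.vec_ne_zero y (hinj' (h0.trans (map_zero _).symm))

end QuiverRep

/-! ### Multihomogeneous polynomials and the Zariski topology -/

namespace QuiverRep

variable {k : Type u} [Field k] {Q : Type q} [Quiver.{h} Q] {n : ℕ} {T : ZnQuiver n Q}
  {𝔙 : QuiverRep.{u, w} k Q} {A : Set Q}

theorem evalAt_smul {K : Type u} [Field K] [Algebra k K] {F : 𝔙.CoordPoly A} {d : A →₀ ℕ}
    (hF : F.IsWeightedHomogeneous
      (fun x : (Σ v : A, Module.Dual k (𝔙.V v)) => Finsupp.single x.1 1) d)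
    (c : A → K) (s : ∀ v : A, K ⊗[k] 𝔙.V v) :
    evalAt (fun v => c v • s v) F = (d.prod fun v e => c v ^ e) * evalAt s F := by
  simp only [evalAt, MvPolynomial.aeval_def, MvPolynomial.eval₂_eq, Finset.mul_sum]
  refine Finset.sum_congr rfl fun m hm => ?_
  have hd : d.prod (fun v e => c v ^ e) = m.prod fun x e => c x.1 ^ e := by
    rw [← hF (MvPolynomial.mem_support_iff.1 hm), Finsupp.weight_apply,
      Finsupp.prod_sum_index (fun _ => pow_zero _) (fun _ => pow_add _)]
    refine Finsupp.prod_congr fun x _ => ?_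
    simp
  simp only [map_smul, smul_eq_mul, mul_pow, Finset.prod_mul_distrib]
  rw [hd, Finsupp.prod]
  ring

theorem evalAt_mul {K : Type u} [Field K] [Algebra k K] (F G : 𝔙.CoordPoly A)
    (s : ∀ v : A, K ⊗[k] 𝔙.V v) : evalAt s (F * G) = evalAt s F * evalAt s G :=
  map_mul _ F G

theorem mem_nonvanishing_iff {P : 𝔙.FieldPoint} {F : 𝔙.CoordPoly A} (hF : IsMultihomogeneous F)
    {x : ∀ v : A, P.K ⊗[k] 𝔙.V v} (hx : ∀ v : A, x v ∈ P.sub.space v) (hx0 : ∀ v, x v ≠ 0) :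
    P ∈ nonvanishing F ↔ evalAt x F ≠ 0 := by
  refine ⟨?_, fun h => ⟨x, hx, h⟩⟩
  rintro ⟨s, hs, hne⟩ h0
  choose c hc using fun v => P.exists_eq_smul (hx v) (hx0 v) (hs v)
  obtain rfl : s = fun v => c v • x v := funext hc
  obtain ⟨d, hd⟩ := hF
  exact hne (by rw [evalAt_smul hd, h0, mul_zero])

variable (A) in
/-- The generators of the lines at the vertices of `A`. -/
noncomputable def FieldPoint.tuple (P : 𝔙.FieldPoint) (v : A) : P.K ⊗[k] 𝔙.V v := P.vec v

theorem mem_nonvanishing_iff_tuple {P : 𝔙.FieldPoint} {F : 𝔙.CoordPoly A}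
    (hF : IsMultihomogeneous F) : P ∈ nonvanishing F ↔ evalAt (P.tuple A) F ≠ 0 :=
  mem_nonvanishing_iff hF (fun v => P.vec_mem v) (fun v => P.vec_ne_zero v)

variable (𝔙 A) in
theorem isTopologicalBasis_nonvanishing :
    @TopologicalSpace.IsTopologicalBasis _ (𝔙.zariski A)
      {U | ∃ F : 𝔙.CoordPoly A, IsMultihomogeneous F ∧ U = nonvanishing F} := by
  let _ := 𝔙.zariski A
  refine ⟨?_, ?_, rfl⟩
  · rintro _ ⟨F, hF, rfl⟩ _ ⟨G, hG, rfl⟩ P ⟨hPF, hPG⟩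
    have hFG : IsMultihomogeneous (F * G) := by
      obtain ⟨d, hd⟩ := hF
      obtain ⟨e, he⟩ := hG
      exact ⟨d + e, hd.mul he⟩
    have hmul : ∀ P : 𝔙.FieldPoint,
        P ∈ nonvanishing (F * G) ↔ P ∈ nonvanishing F ∧ P ∈ nonvanishing G := fun P => by
      rw [mem_nonvanishing_iff_tuple hF, mem_nonvanishing_iff_tuple hG,
        mem_nonvanishing_iff_tuple hFG, evalAt_mul, mul_ne_zero_iff]
    exact ⟨_, ⟨F * G, hFG, rfl⟩, (hmul P).2 ⟨hPF, hPG⟩, fun P' hP' => (hmul P').1 hP'⟩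
  · refine Set.eq_univ_of_forall fun P => ⟨_, ⟨1, ⟨0, MvPolynomial.isWeightedHomogeneous_one _ _⟩,
      rfl⟩, fun v => P.vec v, fun v => P.vec_mem v, ?_⟩
    simp [evalAt]

/-- The nonvanishing of the map along the paths of a given type is an open condition. The line at
the source of the paths is the image of the line at a vertex of `A`, where there are
coordinates. -/
theorem isOpen_along (h𝔙 : 𝔙.IsLinkedNet T) (hpure : 𝔙.IsPure) (hA : 𝔙.OneGeneratedBy A)
    (z : Q) (t : Fin (n + 1) → ℕ) :
    @IsOpen _ (𝔙.zariski A) {P : 𝔙.FieldPoint | P.Along T z t} := by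
  let _ := 𝔙.zariski A
  obtain ⟨v, γ, rfl⟩ := T.exists_type_eq z t
  obtain ⟨a, ha, α, hα⟩ := hA z
  have hset : {P : 𝔙.FieldPoint | P.Along T z (T.type γ)} =
      ⋃ l : Module.Dual k (𝔙.V v), nonvanishing (A := A)
        (MvPolynomial.X ⟨⟨a, ha⟩, l ∘ₗ 𝔙.pathMap γ ∘ₗ 𝔙.pathMap α⟩) := by
    ext P
    have hinj : Function.Injective ((𝔙.pathMap α).baseChange P.K) :=
      Module.Flat.lTensor_preserves_injective_linearMap (M := P.K) _ (hpure _ _ _ hα).1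
    rw [← pathMap_baseChange] at hinj
    have hne : (𝔙.baseChange P.K).pathMap α (P.vec a) ≠ 0 := fun h0 =>
      P.vec_ne_zero a (hinj (h0.trans (map_zero _).symm))
    obtain ⟨c, hc⟩ := P.exists_eq_smul (P.sub.pathMap_mem α (P.vec_mem a)) hne (P.vec_mem z)
    have hc0 : c ≠ 0 := by
      rintro rfl
      exact P.vec_ne_zero z (by rw [hc, zero_smul])
    have hcomp : ∀ (l : Module.Dual k (𝔙.V v)) (x : P.K ⊗[k] 𝔙.V a),
        Module.Dual.baseChange P.K (l ∘ₗ 𝔙.pathMap γ ∘ₗ 𝔙.pathMap α) x =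
          Module.Dual.baseChange P.K l
            ((𝔙.pathMap γ).baseChange P.K ((𝔙.pathMap α).baseChange P.K x)) := by
      intro l x
      induction x using TensorProduct.induction_on with
      | zero => simp
      | tmul c v => simp
      | add x y hx hy => simp only [map_add, hx, hy]
    have heval : ∀ l : Module.Dual k (𝔙.V v),
        evalAt (P.tuple A) (MvPolynomial.X ⟨⟨a, ha⟩, l ∘ₗ 𝔙.pathMap γ ∘ₗ 𝔙.pathMap α⟩) =
          Module.Dual.baseChange P.K l
            ((𝔙.baseChange P.K).pathMap γ ((𝔙.baseChange P.K).pathMap α (P.vec a))) := by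
      intro l
      refine (MvPolynomial.aeval_X _ _).trans ((hcomp l _).trans ?_)
      rw [pathMap_baseChange, pathMap_baseChange]
      rfl
    rw [Set.mem_ofPred_eq, FieldPoint.along_type_iff h𝔙, hc, map_smul, smul_ne_zero_iff_right hc0,
      Set.mem_iUnion]
    simp only [mem_nonvanishing_iff_tuple
      (show IsMultihomogeneous _ from ⟨_, MvPolynomial.isWeightedHomogeneous_X k _ _⟩),
      heval]
    refine ⟨fun h => exists_dual_baseChange_ne_zero h, ?_⟩
    rintro ⟨l, hl⟩ h0
    exact hl ((congrArg (Module.Dual.baseChange P.K l) h0).trans (map_zero _))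
  rw [hset]
  exact isOpen_iUnion fun l => TopologicalSpace.isOpen_generateFrom_of_mem
    ⟨_, ⟨_, MvPolynomial.isWeightedHomogeneous_X k _ _⟩, rfl⟩

end QuiverRep

/-! ### Pencils of vectors over a transcendental extension -/

section Pencil

variable {k : Type*} [Field k] {K : Type*} [Field K] [Algebra k K] {L : Type*} [Field L]
  [Algebra k L] [Algebra K L] [IsScalarTower k K L] {V V₁ : Type*} [AddCommGroup V] [Module k V]
  [AddCommGroup V₁] [Module k V₁]

/-- The vector `a + τ b` with coordinates in an extension field `L` of `K`, for vectors `a`, `b`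
with coordinates in `K` and `τ` in `L`. -/
noncomputable def pencil (τ : L) (a b : K ⊗[k] V) : L ⊗[k] V :=
  (IsScalarTower.toAlgHom k K L).toLinearMap.rTensor V a +
    τ • (IsScalarTower.toAlgHom k K L).toLinearMap.rTensor V b

theorem baseChange_pencil (τ : L) (f : V →ₗ[k] V₁) (a b : K ⊗[k] V) :
    f.baseChange L (pencil τ a b) = pencil τ (f.baseChange K a) (f.baseChange K b) := by
  have key : ∀ x : K ⊗[k] V,
      f.baseChange L ((IsScalarTower.toAlgHom k K L).toLinearMap.rTensor V x) =
        (IsScalarTower.toAlgHom k K L).toLinearMap.rTensor V₁ (f.baseChange K x) := by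
    intro x
    induction x using TensorProduct.induction_on with
    | zero => simp
    | tmul c v => simp
    | add x y hx hy => simp only [map_add, hx, hy]
  rw [pencil, map_add, map_smul, key, key, pencil]

theorem dual_baseChange_pencil (τ : L) (l : Module.Dual k V) (a b : K ⊗[k] V) :
    Module.Dual.baseChange L l (pencil τ a b) =
      algebraMap K L (Module.Dual.baseChange K l a) +
        τ * algebraMap K L (Module.Dual.baseChange K l b) := by
  have key : ∀ x : K ⊗[k] V,
      Module.Dual.baseChange L l ((IsScalarTower.toAlgHom k K L).toLinearMap.rTensor V x) =
        algebraMap K L (Module.Dual.baseChange K l x) := by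
    intro x
    induction x using TensorProduct.induction_on with
    | zero => simp
    | tmul c v => simp [Algebra.smul_def, ← IsScalarTower.algebraMap_apply]
    | add x y hx hy => simp only [map_add, hx, hy]
  rw [pencil, map_add, map_smul, key, key, smul_eq_mul]

theorem pencil_smul_smul (τ : L) (c : K) (a b : K ⊗[k] V) :
    pencil τ (c • a) (c • b) = algebraMap K L c • pencil τ a b := by
  have key : ∀ x : K ⊗[k] V,
      (IsScalarTower.toAlgHom k K L).toLinearMap.rTensor V (c • x) =
        algebraMap K L c • (IsScalarTower.toAlgHom k K L).toLinearMap.rTensor V x := by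
    intro x
    induction x using TensorProduct.induction_on with
    | zero => simp
    | tmul c v => simp [TensorProduct.smul_tmul', Algebra.smul_def]
    | add x y hx hy => simp only [map_add, smul_add, hx, hy]
  rw [pencil, key, key, pencil, smul_add, smul_comm τ]

theorem pencil_zero_left (τ : L) (b : K ⊗[k] V) : pencil τ 0 b = τ • pencil τ b 0 := by
  simp [pencil]

@[simp]
theorem pencil_zero_zero (τ : L) : pencil τ (0 : K ⊗[k] V) 0 = 0 := by
  simp [pencil]

/-- The value of a linear functional at `a + τ b` is the value at `τ` of a polynomial over `K`. -/
theorem dual_baseChange_pencil_eq_aeval (τ : L) (l : Module.Dual k V) (a b : K ⊗[k] V) :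
    Module.Dual.baseChange L l (pencil τ a b) =
      Polynomial.aeval τ (Polynomial.C (Module.Dual.baseChange K l a) +
        Polynomial.X * Polynomial.C (Module.Dual.baseChange K l b)) := by
  rw [dual_baseChange_pencil, map_add, map_mul, Polynomial.aeval_C, Polynomial.aeval_C,
    Polynomial.aeval_X]

theorem pencil_ne_zero {τ : L} (hτ : Transcendental K τ) {a b : K ⊗[k] V} (h : a ≠ 0 ∨ b ≠ 0) :
    pencil τ a b ≠ 0 := by
  intro h0
  obtain ⟨l, hl⟩ : ∃ l : Module.Dual k V,
      Module.Dual.baseChange K l a ≠ 0 ∨ Module.Dual.baseChange K l b ≠ 0 := by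
    rcases h with h | h <;> obtain ⟨l, hl⟩ := exists_dual_baseChange_ne_zero h
    exacts [⟨l, .inl hl⟩, ⟨l, .inr hl⟩]
  have h1 := dual_baseChange_pencil_eq_aeval τ l a b
  rw [h0, map_zero] at h1
  have h2 := transcendental_iff.1 hτ _ h1.symm
  have c0 := congrArg (Polynomial.coeff · 0) h2
  have c1 := congrArg (Polynomial.coeff · 1) h2
  simp [Polynomial.coeff_C] at c0 c1
  exact hl.elim (· c0) (· c1)

end Pencil

namespace QuiverRep

variable {k : Type u} [Field k] {Q : Type q} [Quiver.{h} Q] {n : ℕ} {T : ZnQuiver n Q}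
  {𝔙 : QuiverRep.{u, w} k Q}

theorem evalAt_pencil_ne_zero {A : Set Q} {K L : Type u} [Field K] [Algebra k K] [Field L]
    [Algebra k L] [Algebra K L] [IsScalarTower k K L] {τ : L} (hτ : Transcendental K τ)
    (a b : ∀ v : A, K ⊗[k] 𝔙.V v) {F : 𝔙.CoordPoly A} (hF : evalAt a F ≠ 0) :
    evalAt (fun v => pencil τ (a v) (b v)) F ≠ 0 := by
  -- the value at the pencil comes from a polynomial, whose value at zero is the value at `a`
  let f : (Σ v : A, Module.Dual k (𝔙.V v)) → Polynomial K := fun x =>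
    Polynomial.C (Module.Dual.baseChange K x.2 (a x.1)) +
      Polynomial.X * Polynomial.C (Module.Dual.baseChange K x.2 (b x.1))
  have h1 : evalAt (fun v => pencil τ (a v) (b v)) F =
      (Polynomial.aeval τ).restrictScalars k (MvPolynomial.aeval f F) := by
    rw [evalAt, MvPolynomial.comp_aeval_apply]
    exact congrArg (MvPolynomial.aeval · F)
      (funext fun x => dual_baseChange_pencil_eq_aeval τ x.2 (a x.1) (b x.1))
  have h2 : evalAt a F =
      (Polynomial.aeval (0 : K)).restrictScalars k (MvPolynomial.aeval f F) := by
    rw [evalAt, MvPolynomial.comp_aeval_apply]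
    exact congrArg (MvPolynomial.aeval · F) (funext fun x => by simp [f])
  intro h0
  rw [h1] at h0
  rw [h2, transcendental_iff.1 hτ _ h0, map_zero] at hF
  exact hF rfl

/-- The point whose lines are spanned by given vectors. -/
noncomputable def FieldPoint.ofVec (L : Type u) [Field L] [Algebra k L]
    (s : ∀ v, (𝔙.baseChange L).V v) (hs : ∀ v, s v ≠ 0)
    (hmap : ∀ ⦃u v : Q⦄ (e : u ⟶ v), ∃ c : L, (𝔙.baseChange L).map e (s u) = c • s v) :
    𝔙.FieldPoint where
  K := L
  sub :=
    { space := fun v => Submodule.span L {s v}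
      map_mem := by
        intro u v e x hx
        obtain ⟨c, rfl⟩ := Submodule.mem_span_singleton.1 hx
        obtain ⟨d, hd⟩ := hmap e
        rw [map_smul, hd]
        exact Submodule.smul_mem _ _ (Submodule.smul_mem _ _
          (Submodule.mem_span_singleton_self _)) }
  finrank_space v := finrank_span_singleton (hs v)

theorem FieldPoint.mem_nonvanishing_ofVec {A : Set Q} {L : Type u} [Field L] [Algebra k L]
    {s : ∀ v, (𝔙.baseChange L).V v} (hs hmap) {F : 𝔙.CoordPoly A}
    (hF : evalAt (K := L) (fun v : A => s v) F ≠ 0) :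
    FieldPoint.ofVec L s hs hmap ∈ nonvanishing F :=
  ⟨fun v => s v, fun v => show s v ∈ Submodule.span L {s v} from
    Submodule.mem_span_singleton_self _, hF⟩

/-- A point whose lines are spanned by vectors `a v + τ b v` with `τ` transcendental specializes to
the point whose lines are spanned by the vectors `a v`. -/
theorem FieldPoint.mem_closure_ofVec {A : Set Q} (P : 𝔙.FieldPoint) {L : Type u} [Field L]
    [Algebra k L] [Algebra P.K L] [IsScalarTower k P.K L] {τ : L} (hτ : Transcendental P.K τ)
    {a : ∀ v, P.K ⊗[k] 𝔙.V v} (ha : ∀ v, a v ∈ P.sub.space v) (ha0 : ∀ v, a v ≠ 0)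
    (b : ∀ v, P.K ⊗[k] 𝔙.V v) (hs hmap) :
    P ∈ @closure _ (𝔙.zariski A) {FieldPoint.ofVec L (fun v => pencil τ (a v) (b v)) hs hmap} := by
  let _ := 𝔙.zariski A
  refine (𝔙.isTopologicalBasis_nonvanishing A).mem_closure_iff.2 ?_
  rintro _ ⟨F, hF, rfl⟩ hPF
  refine ⟨_, ?_, rfl⟩
  have h1 : evalAt (fun v : A => a v) F ≠ 0 :=
    (mem_nonvanishing_iff hF (fun v => ha v) (fun v => ha0 v)).1 hPF
  exact mem_nonvanishing_ofVec hs hmap (evalAt_pencil_ne_zero hτ _ (fun v : A => b v) h1)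

end QuiverRep

/-! ### Merging two consecutive sources -/

namespace ZnQuiver.IsLineNet

variable {n : ℕ} {Q : Type q} [Quiver.{h} Q] {T : ZnQuiver n Q}
  {G : Q → (Fin (n + 1) → ℕ) → Prop}

/-- A generating set of vertices none of which generates another consists of the sources. -/
theorem setOf_isSource_eq (hG : T.IsLineNet G) {B S : Set Q} (hB : B.Finite)
    (hBgen : ∀ x, ∃ y ∈ B, T.Generates G y x) (hgen : ∀ x, ∃ y ∈ S, T.Generates G y x)
    (hanti : ∀ x ∈ S, ∀ y ∈ S, T.Generates G x y → x = y) : {v | T.IsSource G v} = S := by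
  refine Set.Subset.antisymm (fun x hx => hx.mem_of_generates hgen) fun x hx => ?_
  obtain ⟨y, hy, hyx⟩ := hG.exists_isSource_generates hB hBgen x
  exact hanti y (hy.mem_of_generates hgen) x hx hyx ▸ hy

end ZnQuiver.IsLineNet

namespace QuiverRep

variable {k : Type u} [Field k] {Q : Type q} [Quiver.{h} Q] {n : ℕ} {T : ZnQuiver n Q}
  {𝔙 : QuiverRep.{u, w} k Q}

section PencilAt

variable {K L : Type u} [Field K] [Algebra k K] [Field L] [Algebra k L] [Algebra K L]
  [IsScalarTower k K L] (τ : L)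

variable (𝔙) in
/-- The vector `a + τ b` in the base change to `L` of the space at a vertex. -/
noncomputable def pencilAt {v : Q} (a b : (𝔙.baseChange K).V v) : (𝔙.baseChange L).V v :=
  pencil (K := K) (V := 𝔙.V v) τ a b

theorem pathMap_pencilAt {u v : Q} (γ : Quiver.Path u v) (a b : (𝔙.baseChange K).V u) :
    (𝔙.baseChange L).pathMap γ (𝔙.pencilAt τ a b) =
      𝔙.pencilAt τ ((𝔙.baseChange K).pathMap γ a) ((𝔙.baseChange K).pathMap γ b) := by
  rw [pathMap_baseChange, pathMap_baseChange]
  exact baseChange_pencil τ (𝔙.pathMap γ) a b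

theorem pencilAt_smul_smul {v : Q} (c : K) (a b : (𝔙.baseChange K).V v) :
    𝔙.pencilAt τ (c • a) (c • b) = algebraMap K L c • 𝔙.pencilAt τ a b :=
  pencil_smul_smul τ c a b

theorem pencilAt_zero_left {v : Q} (b : (𝔙.baseChange K).V v) :
    𝔙.pencilAt τ 0 b = τ • 𝔙.pencilAt τ b 0 :=
  pencil_zero_left τ b

theorem pencilAt_zero_zero {v : Q} : 𝔙.pencilAt τ (0 : (𝔙.baseChange K).V v) 0 = 0 :=
  pencil_zero_zero τ

variable {τ} in
theorem pencilAt_ne_zero_iff (hτ : Transcendental K τ) {v : Q} {a b : (𝔙.baseChange K).V v} :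
    𝔙.pencilAt τ a b ≠ 0 ↔ a ≠ 0 ∨ b ≠ 0 := by
  refine ⟨fun h => ?_, fun h => pencil_ne_zero hτ h⟩
  by_contra! h0
  exact h (by rw [h0.1, h0.2, pencilAt_zero_zero])

end PencilAt

theorem FieldPoint.generates_iff_of_mem (h𝔙 : 𝔙.IsLinkedNet T) {P : 𝔙.FieldPoint} {x y : Q}
    {z : (𝔙.baseChange P.K).V x} (hz : z ∈ P.sub.space x) (hz0 : z ≠ 0) :
    T.Generates (P.Along T) x y ↔
      ∃ γ : Quiver.Path x y, (𝔙.baseChange P.K).pathMap γ z ≠ 0 := by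
  constructor
  · rw [generates_iff h𝔙]
    rintro ⟨γ, hγ⟩
    refine ⟨γ, fun h0 => hγ ?_⟩
    obtain ⟨c, hc⟩ := P.exists_eq_smul hz hz0 (P.vec_mem x)
    rw [hc, map_smul, h0, smul_zero]
  · rintro ⟨γ, hγ⟩
    exact ⟨T.type γ, T.translate_type γ, along_of_ne_zero γ hz hγ⟩

theorem FieldPoint.generates_ofVec_iff (h𝔙 : 𝔙.IsLinkedNet T) {L : Type u} [Field L]
    [Algebra k L] {s : ∀ v, (𝔙.baseChange L).V v} (hs hmap) {x y : Q} :
    T.Generates ((FieldPoint.ofVec L s hs hmap).Along T) x y ↔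
      ∃ γ : Quiver.Path x y, (𝔙.baseChange L).pathMap γ (s x) ≠ 0 :=
  generates_iff_of_mem (P := FieldPoint.ofVec L s hs hmap) h𝔙
    (Submodule.mem_span_singleton_self (R := L) (s x)) (hs x)

/-- If `p` is a source of a point and `v ≠ p` is the vertex reached from `p` along the least type
whose map vanishes, then the point is a specialization of one whose sources are those of the former
except `v`. By exactness the generator at `v` is the image of a vector `b` at `p`; the new point has
at `p` the line spanned by `w + τ b`, for the generator `w` at `p` and a transcendental `τ`. It
maps to the old line at `v`, because `w` vanishes there, and the lines at all vertices not
generated by `p` are kept. -/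
theorem FieldPoint.exists_merge (h𝔙 : 𝔙.IsLinkedNet T) (hexact : 𝔙.IsExact T) {B : Set Q}
    (hB : B.Finite)
    (hBgen : ∀ (P : 𝔙.FieldPoint) (x : Q), ∃ y ∈ B, T.Generates (P.Along T) y x)
    (P : 𝔙.FieldPoint) {p : Q} (hp : p ∈ P.sources T) {e : Fin (n + 1) → ℕ}
    (he : IsLeast {t | ¬ P.Along T p t} e) (hne : T.translate p e ≠ p) (A : Set Q) :
    ∃ P' : 𝔙.FieldPoint, P ∈ @closure _ (𝔙.zariski A) {P'} ∧
      P'.sources T = P.sources T \ {T.translate p e} := by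
  have hG := P.isLineNet h𝔙
  have h𝔘 := h𝔙.baseChange P.K
  have hv : T.IsSource (P.Along T) (T.translate p e) := hG.isSource_translate hp he
  obtain ⟨γ, hγ⟩ := T.exists_path p e
  generalize hvdef : T.translate p e = v at *
  -- the generator at `v` lifts to `p` by exactness
  have hγ0 : (𝔙.baseChange P.K).pathMap γ (P.vec p) = 0 := by
    by_contra h0
    exact he.1 (hγ ▸ (along_type_iff h𝔙 γ).2 h0)
  obtain ⟨s, hs⟩ := exists_add_of_le (hG.isLeast_le_one he)
  have hvs : T.translate v s = p := by
    rw [← hvdef, ← T.translate_add, ← hs, T.translate_eq_self_iff]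
    exact ⟨1, fun _ => rfl⟩
  obtain ⟨δ, hδ⟩ := T.exists_path_of_translate_eq hvs
  have hδ0 : (𝔙.baseChange P.K).pathMap δ (P.vec v) = 0 := by
    by_contra h0
    exact hne (hp v ⟨s, hvs, hδ ▸ (along_type_iff h𝔙 δ).2 h0⟩)
  obtain ⟨b₀, hb₀⟩ : ∃ b₀, (𝔙.baseChange P.K).pathMap γ b₀ = P.vec v := by
    have hsum : ∀ a, e a + s a = 1 := fun a => (congrFun hs a).symm
    have hγadm : IsAdmissible T.ty γ := by
      by_contra h0
      refine hne ?_
      rw [← hvdef, T.translate_eq_self_iff]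
      refine ⟨1, fun a => ?_⟩
      have h1 : e a ≠ 0 := fun h => h0 ⟨a, (congrFun hγ a).trans h⟩
      have := hsum a
      omega
    have hδadm : IsAdmissible T.ty δ := by
      obtain ⟨a, ha⟩ := Function.ne_iff.1 (hG.isLeast_ne_zero he)
      refine ⟨a, (congrFun hδ a).trans ?_⟩
      have := hsum a
      simp only [Pi.zero_apply] at ha
      omega
    have hrange := hexact.baseChange P.K p v
      ⟨hne.symm, γ, fun a => (congrFun hγ a).le.trans (hG.isLeast_le_one he a)⟩ γ δ hγadm hδadm
    have : P.vec v ∈ LinearMap.range ((𝔙.baseChange P.K).pathMap γ) := by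
      rw [hrange]
      exact hδ0
    exact this
  -- a path from `p` along which the generator vanishes factors through `v`
  have hfactor : ∀ {y : Q} (α : Quiver.Path p y), (𝔙.baseChange P.K).pathMap α (P.vec p) = 0 →
      ∃ (β : Quiver.Path v y) (c : P.K), (𝔙.baseChange P.K).pathMap α b₀ =
        c • (𝔙.baseChange P.K).pathMap β (P.vec v) := by
    intro y α hα
    obtain ⟨t, ht⟩ := exists_add_of_le
      (he.2 fun h => (along_type_iff h𝔙 α).1 h hα : e ≤ T.type α)
    have hvy : T.translate v t = y := by
      rw [← hvdef, ← T.translate_add, ← ht, T.translate_type]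
    obtain ⟨β, rfl⟩ := T.exists_path_of_translate_eq hvy
    obtain ⟨c, hc⟩ := h𝔘.exists_pathMap_eq_smul α (γ.comp β) (by rw [T.type_comp, ht, hγ])
    refine ⟨β, c, ?_⟩
    rw [hc, LinearMap.smul_apply, pathMap_comp_apply, hb₀]
  -- the vectors of the pencil
  have hab : ∀ x, ∃ a b : (𝔙.baseChange P.K).V x, a ∈ P.sub.space x ∧ a ≠ 0 ∧
      ((∃ α : Quiver.Path p x, a = (𝔙.baseChange P.K).pathMap α (P.vec p) ∧
          b = (𝔙.baseChange P.K).pathMap α b₀) ∨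
        ¬ T.Generates (P.Along T) p x ∧ a = P.vec x ∧ b = 0) := by
    intro x
    by_cases hx : T.Generates (P.Along T) p x
    · obtain ⟨α, hα⟩ := (generates_iff h𝔙).1 hx
      exact ⟨_, _, P.sub.pathMap_mem α (P.vec_mem p), hα, .inl ⟨α, rfl, rfl⟩⟩
    · exact ⟨_, _, P.vec_mem x, P.vec_ne_zero x, .inr ⟨hx, rfl, rfl⟩⟩
  choose a b ha ha0 hab using hab
  have hgen : ∀ {x y : Q} (α : Quiver.Path x y) {z}, z ∈ P.sub.space x →
      (𝔙.baseChange P.K).pathMap α z ≠ 0 → T.Generates (P.Along T) x y :=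
    fun α _ hz h => ⟨T.type α, T.translate_type α, along_of_ne_zero α hz h⟩
  have hin : ∀ {y : Q} (α : Quiver.Path p y), T.Generates (P.Along T) p y →
      ∃ c : P.K, (𝔙.baseChange P.K).pathMap α (P.vec p) = c • a y ∧
        (𝔙.baseChange P.K).pathMap α b₀ = c • b y := by
    intro y α hy
    obtain ⟨β, hβa, hβb⟩ | ⟨hy', -⟩ := hab y
    · have hβ : IsAdmissible T.ty β := by
        by_contra h0
        exact ha0 y (by rw [hβa, h𝔘.pathMap_eq_zero β h0, LinearMap.zero_apply])
      obtain ⟨c, hc⟩ := h𝔘.smul_admissible α β hβ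
      exact ⟨c, by rw [hc, hβa, LinearMap.smul_apply], by rw [hc, hβb, LinearMap.smul_apply]⟩
    · exact absurd hy hy'
  have hout : ∀ {x}, ¬ T.Generates (P.Along T) p x → a x = P.vec x ∧ b x = 0 := by
    intro x hx
    obtain ⟨α, hα, -⟩ | ⟨-, h⟩ := hab x
    · exact absurd (hgen α (P.vec_mem p) (hα ▸ ha0 x)) hx
    · exact h
  let τ : RatFunc P.K := RatFunc.X
  have hτ : Transcendental P.K τ := RatFunc.transcendental_X
  have hs0 : ∀ x, 𝔙.pencilAt τ (a x) (b x) ≠ 0 := fun x =>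
    (pencilAt_ne_zero_iff hτ).2 (.inl (ha0 x))
  have hmap : ∀ ⦃x y : Q⦄ (ε : x ⟶ y), ∃ c : RatFunc P.K,
      (𝔙.baseChange (RatFunc P.K)).map ε (𝔙.pencilAt τ (a x) (b x)) =
        c • 𝔙.pencilAt τ (a y) (b y) := by
    intro x y ε
    have hε : (𝔙.baseChange (RatFunc P.K)).map ε (𝔙.pencilAt τ (a x) (b x)) =
        𝔙.pencilAt τ ((𝔙.baseChange P.K).map ε (a x)) ((𝔙.baseChange P.K).map ε (b x)) :=
      pathMap_pencilAt τ ε.toPath (a x) (b x)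
    rw [hε]
    by_cases hy : T.Generates (P.Along T) p y
    · by_cases hx : T.Generates (P.Along T) p x
      · obtain ⟨α, hαa, hαb⟩ := (hab x).resolve_right fun h => h.1 hx
        obtain ⟨c, hca, hcb⟩ := hin (α.cons ε) hy
        refine ⟨algebraMap _ _ c, ?_⟩
        rw [hαa, hαb, ← pencilAt_smul_smul, ← hca, ← hcb]
        rfl
      · -- otherwise `y` would be generated by two sources
        refine ⟨0, ?_⟩
        rw [(hout hx).1, (hout hx).2, map_zero, zero_smul]
        have h0 : (𝔙.baseChange P.K).map ε (P.vec x) = 0 := by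
          by_contra h0
          obtain ⟨q, hq, hqx⟩ := hG.exists_isSource_generates hB (hBgen P) x
          have hqy := hG.generates_trans hqx (hgen ε.toPath (P.vec_mem x) h0)
          exact hx (hG.isSource_unique hq hp hqy hy ▸ hqx)
        rw [h0, pencilAt_zero_zero]
    · rw [(hout hy).1, (hout hy).2]
      by_cases hx : T.Generates (P.Along T) p x
      · obtain ⟨α, hαa, hαb⟩ := (hab x).resolve_right fun h => h.1 hx
        have h0 : (𝔙.baseChange P.K).pathMap (α.cons ε) (P.vec p) = 0 := by
          by_contra h0
          exact hy (hgen _ (P.vec_mem p) h0)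
        obtain ⟨β, c, hc⟩ := hfactor (α.cons ε) h0
        obtain ⟨d, hd⟩ := P.exists_eq_smul_vec (P.sub.pathMap_mem β (P.vec_mem v))
        refine ⟨τ * algebraMap _ _ (c * d), ?_⟩
        rw [hd, smul_smul] at hc
        have h1 : (𝔙.baseChange P.K).map ε (a x) = 0 := by rw [hαa]; exact h0
        have h2 : (𝔙.baseChange P.K).map ε (b x) = (c * d) • P.vec y := by rw [hαb]; exact hc
        rw [h1, h2, mul_smul τ, ← pencilAt_smul_smul, smul_zero, pencilAt_zero_left]
      · obtain ⟨c, hc⟩ := P.exists_eq_smul_vec (P.sub.map_mem ε _ (P.vec_mem x))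
        refine ⟨algebraMap _ _ c, ?_⟩
        rw [(hout hx).1, (hout hx).2, hc, map_zero, ← pencilAt_smul_smul, smul_zero]
  refine ⟨FieldPoint.ofVec (RatFunc P.K) (fun x => 𝔙.pencilAt τ (a x) (b x)) hs0 hmap,
    P.mem_closure_ofVec hτ ha ha0 b hs0 hmap, ?_⟩
  have hgen_of_not : ∀ {x y : Q}, ¬ T.Generates (P.Along T) p x →
      (T.Generates ((FieldPoint.ofVec (RatFunc P.K) _ hs0 hmap).Along T) x y ↔
        T.Generates (P.Along T) x y) := by
    intro x y hx
    rw [generates_ofVec_iff h𝔙, generates_iff h𝔙]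
    refine exists_congr fun α => ?_
    rw [pathMap_pencilAt, pencilAt_ne_zero_iff hτ, (hout hx).1, (hout hx).2, map_zero]
    simp only [ne_eq, not_true_eq_false, or_false]
  have hgen_p : ∀ {y : Q},
      T.Generates ((FieldPoint.ofVec (RatFunc P.K) _ hs0 hmap).Along T) p y ↔
        T.Generates (P.Along T) p y ∨ T.Generates (P.Along T) v y := by
    intro y
    obtain ⟨c, hca, hcb⟩ := hin (.nil : Quiver.Path p p) (hG.generates_refl p)
    have hc : c ≠ 0 := by
      rintro rfl
      exact P.vec_ne_zero p (hca.trans (zero_smul _ _))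
    have hiff : T.Generates ((FieldPoint.ofVec (RatFunc P.K) _ hs0 hmap).Along T) p y ↔
        ∃ α : Quiver.Path p y, (𝔙.baseChange P.K).pathMap α (P.vec p) ≠ 0 ∨
          (𝔙.baseChange P.K).pathMap α b₀ ≠ 0 := by
      rw [generates_ofVec_iff h𝔙]
      refine exists_congr fun α => ?_
      have h1 : P.vec p = c • a p := hca
      have h2 : b₀ = c • b p := hcb
      rw [pathMap_pencilAt, pencilAt_ne_zero_iff hτ, h1, h2, map_smul, map_smul,
        smul_ne_zero_iff_right hc, smul_ne_zero_iff_right hc]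
    rw [hiff]
    constructor
    · rintro ⟨α, hα⟩
      by_cases h0 : (𝔙.baseChange P.K).pathMap α (P.vec p) = 0
      · obtain ⟨β, d, hd⟩ := hfactor α h0
        refine .inr (hgen β (P.vec_mem v) fun h1 => ?_)
        exact hα.elim (· h0) (· (by rw [hd, h1, smul_zero]))
      · exact .inl (hgen α (P.vec_mem p) h0)
    · rintro (hy | hy) <;> obtain ⟨β, hβ⟩ := (generates_iff h𝔙).1 hy
      · exact ⟨β, .inl hβ⟩
      · exact ⟨γ.comp β, .inr (by rwa [pathMap_comp_apply, hb₀])⟩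
  have hnot : ∀ q ∈ P.sources T, q ≠ p → ¬ T.Generates (P.Along T) p q :=
    fun q hq hqp h => hqp (hq p h).symm
  refine (isLineNet _ h𝔙).setOf_isSource_eq hB (hBgen _) (fun x => ?_) ?_
  · obtain ⟨q, hq, hqx⟩ := hG.exists_isSource_generates hB (hBgen P) x
    by_cases hqv : q = v
    · exact ⟨p, ⟨hp, hne.symm⟩, hgen_p.2 (.inr (hqv ▸ hqx))⟩
    by_cases hqp : q = p
    · exact ⟨p, ⟨hp, hne.symm⟩, hgen_p.2 (.inl (hqp ▸ hqx))⟩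
    · exact ⟨q, ⟨hq, hqv⟩, (hgen_of_not (hnot q hq hqp)).2 hqx⟩
  · rintro x ⟨hx, hxv⟩ y ⟨hy, hyv⟩ hxy
    by_cases hxp : x = p
    · subst hxp
      exact (hgen_p.1 hxy).elim (hy x) fun h => absurd (hy v h).symm hyv
    · exact hy x ((hgen_of_not (hnot x hx hxp)).1 hxy)

end QuiverRep

/-! ### Sources and the closures of the sets of points generated by a vertex -/

namespace QuiverRep

variable {k : Type u} [Field k] {Q : Type q} [Quiver.{h} Q] {n : ℕ} {T : ZnQuiver n Q}
  {𝔙 : QuiverRep.{u, w} k Q}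

theorem FieldPoint.mem_closure_sources_eq (h𝔙 : 𝔙.IsLinkedNet T) (hexact : 𝔙.IsExact T)
    {B : Set Q} (hB : B.Finite)
    (hBgen : ∀ (P : 𝔙.FieldPoint) (x : Q), ∃ y ∈ B, T.Generates (P.Along T) y x)
    (A : Set Q) {H : Set Q} (hH : H.Nonempty) (P : 𝔙.FieldPoint) (hP : H ⊆ P.sources T) :
    P ∈ @closure _ (𝔙.zariski A) {P' | P'.sources T = H} := by
  let _ := 𝔙.zariski A
  have hfin : ∀ P : 𝔙.FieldPoint, (P.sources T).Finite := fun P =>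
    hB.subset fun x hx => ZnQuiver.IsSource.mem_of_generates (hBgen P) hx
  induction hm : (P.sources T \ H).ncard using Nat.strong_induction_on generalizing P with
  | _ m ih =>
    have hG := P.isLineNet h𝔙
    by_cases hstable : ∀ p ∈ H, ∀ e, IsLeast {t | ¬ P.Along T p t} e → T.translate p e ∈ H
    · refine subset_closure (hP.antisymm' fun x hx => ?_)
      obtain ⟨y, hy, hyx⟩ := hG.exists_generates_of_stable hH hstable x
      exact hx y hyx ▸ hy
    push Not at hstable
    obtain ⟨p, hp, e, he, hpe⟩ := hstable
    obtain ⟨P', hPP', hP'⟩ := P.exists_merge h𝔙 hexact hB hBgen (hP hp) he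
      (fun h => hpe (h.symm ▸ hp)) A
    have hHP' : H ⊆ P'.sources T := fun x hx =>
      hP' ▸ ⟨hP hx, fun h => hpe ((Set.mem_singleton_iff.1 h) ▸ hx)⟩
    refine closure_minimal (Set.singleton_subset_iff.2 (ih _ ?_ P' hHP' rfl)) isClosed_closure hPP'
    rw [← hm, hP']
    refine Set.ncard_lt_ncard ?_ ((hfin P).sdiff)
    refine ⟨fun x hx => ⟨hx.1.1, hx.2⟩, fun hsub => ?_⟩
    exact (hsub ⟨hG.isSource_translate (hP hp) he, hpe⟩).1.2 rfl

variable {A : Set Q}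

theorem FieldPoint.toLP_mem_closure_iff {S : Set 𝔙.FieldPoint} {P : 𝔙.FieldPoint} :
    P.toLP A ∈ closure (FieldPoint.toLP A '' S) ↔ P ∈ @closure _ (𝔙.zariski A) S := by
  let _ := 𝔙.zariski A
  rw [(SeparationQuotient.isInducing_mk (X := 𝔙.FieldPoint)).closure_eq_preimage_closure_image]
  rfl

theorem FieldPoint.toLP_mem_LPvert_iff (h𝔙 : 𝔙.IsLinkedNet T) (hpure : 𝔙.IsPure)
    (hexact : 𝔙.IsExact T) {B : Set Q} (hB : B.Finite)
    (hBgen : ∀ (P : 𝔙.FieldPoint) (x : Q), ∃ y ∈ B, T.Generates (P.Along T) y x)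
    (hA : 𝔙.OneGeneratedBy A) {P : 𝔙.FieldPoint} {v : Q} :
    P.toLP A ∈ 𝔙.LPvert A v ↔ v ∈ P.sources T := by
  let _ := 𝔙.zariski A
  have hgen : 𝔙.LPgen A v =
      FieldPoint.toLP A '' {P : 𝔙.FieldPoint | P.sub.toRep.GeneratedBy {v}} :=
    Set.ext fun x => exists_congr fun P => and_comm
  rw [LPvert, hgen, toLP_mem_closure_iff]
  constructor
  · rintro hP z ⟨t, hz, ht⟩
    -- the nonvanishing of the map from `z` to `v` would spread to a point generated by `v`
    obtain ⟨P', ht', hP'⟩ := mem_closure_iff.1 hP _ (isOpen_along h𝔙 hpure hA z t) ht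
    exact (P'.isLineNet h𝔙).generates_antisymm ⟨t, hz, ht'⟩
      ((generatedBy_singleton_iff h𝔙).1 hP' z)
  · intro hv
    refine closure_mono (fun P' hP' => ?_) (P.mem_closure_sources_eq h𝔙 hexact hB hBgen A
      (Set.singleton_nonempty v) (Set.singleton_subset_iff.2 hv))
    refine (generatedBy_singleton_iff h𝔙).2 fun x => ?_
    obtain ⟨y, hy, hyx⟩ := (P'.isLineNet h𝔙).exists_isSource_generates hB (hBgen P') x
    have hP'' : P'.sources T = {v} := hP'
    have hyv : y ∈ ({v} : Set Q) := hP'' ▸ hy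
    exact Set.mem_singleton_iff.1 hyv ▸ hyx

/-- A point is `1`-generated by exactly the sets containing its sources. -/
theorem FieldPoint.minimallyOneGeneratedBy_iff (h𝔙 : 𝔙.IsLinkedNet T) {B : Set Q}
    (hB : B.Finite)
    (hBgen : ∀ (P : 𝔙.FieldPoint) (x : Q), ∃ y ∈ B, T.Generates (P.Along T) y x)
    {P : 𝔙.FieldPoint} {H : Set Q} :
    P.sub.toRep.MinimallyOneGeneratedBy H ↔ P.sources T = H := by
  have hone : ∀ H : Set Q, P.sub.toRep.OneGeneratedBy H ↔ P.sources T ⊆ H := by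
    intro H
    rw [oneGeneratedBy_iff h𝔙]
    refine ⟨fun hgen x hx => ZnQuiver.IsSource.mem_of_generates hgen hx, fun hsub x => ?_⟩
    obtain ⟨y, hy, hyx⟩ := (P.isLineNet h𝔙).exists_isSource_generates hB (hBgen P) x
    exact ⟨y, hsub hy, hyx⟩
  simp only [MinimallyOneGeneratedBy, hone]
  constructor
  · rintro ⟨hsub, hmin⟩
    by_contra hne
    exact hmin _ (hsub.ssubset_of_ne hne) subset_rfl
  · rintro rfl
    exact ⟨subset_rfl, fun H' hH' hsub => hH'.2 hsub⟩

theorem FieldPoint.exists_toLP_eq (x : 𝔙.LP A) : ∃ P : 𝔙.FieldPoint, P.toLP A = x := by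
  let _ := 𝔙.zariski A
  exact SeparationQuotient.surjective_mk (X := 𝔙.FieldPoint) x

end QuiverRep

theorem mainTheorem8 {n : ℕ} {k : Type u} [Field k] {Q : Type q} [Quiver.{h} Q]
    (T : ZnQuiver n Q) (𝔙 : QuiverRep.{u, w} k Q)
    (hlinked : 𝔙.IsLinkedNet T) (hpure : 𝔙.IsPure) (hnontrivial : 𝔙.IsNontrivial)
    (hexact : 𝔙.IsExact T) (hfg : 𝔙.FinitelyGenerated)
    (A : Set Q) (hA : 𝔙.OneGeneratedBy A) (H : Set Q) (hH : H.Finite) :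
    (∀ P : 𝔙.FieldPoint,
      P.toLP A ∈ 𝔙.LPstratum A H ↔ P.sub.toRep.MinimallyOneGeneratedBy H) ∧
    IsOpen {x : 𝔙.LPinter A H | (x : 𝔙.LP A) ∈ 𝔙.LPstratum A H} ∧
    (H.Nonempty → Dense {x : 𝔙.LPinter A H | (x : 𝔙.LP A) ∈ 𝔙.LPstratum A H}) := by
  obtain ⟨B, hB, hBgen⟩ := QuiverRep.exists_finite_generates hlinked hpure hnontrivial hfg
  have hvert : ∀ (P : 𝔙.FieldPoint) (v : Q), P.toLP A ∈ 𝔙.LPvert A v ↔ v ∈ P.sources T :=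
    fun P v =>
      QuiverRep.FieldPoint.toLP_mem_LPvert_iff hlinked hpure hexact hB hBgen hA
  have hinter : ∀ P : 𝔙.FieldPoint, P.toLP A ∈ 𝔙.LPinter A H ↔ H ⊆ P.sources T := fun P => by
    simp only [QuiverRep.LPinter, Set.mem_iInter, hvert]
    rfl
  have hstratum : ∀ P : 𝔙.FieldPoint, P.toLP A ∈ 𝔙.LPstratum A H ↔ P.sources T = H := fun P => by
    simp only [QuiverRep.LPstratum, Set.mem_sdiff, hinter, Set.mem_iUnion, hvert, Set.mem_compl_iff,
      exists_prop, not_exists, not_and, not_imp_not]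
    exact ⟨fun h => Set.Subset.antisymm h.2 h.1, fun h => ⟨h.ge, h.le⟩⟩
  refine ⟨fun P => ?_, ?_, fun hne => ?_⟩
  · rw [hstratum, QuiverRep.FieldPoint.minimallyOneGeneratedBy_iff hlinked hB hBgen]
  · -- only the finitely many vertices of `B` contribute to the union removed from `LPinter`
    have heq : {x : 𝔙.LPinter A H | (x : 𝔙.LP A) ∈ 𝔙.LPstratum A H} =
        Subtype.val ⁻¹' (⋃ v ∈ B \ H, 𝔙.LPvert A v)ᶜ := by
      ext ⟨x, hx⟩
      obtain ⟨P, rfl⟩ := QuiverRep.FieldPoint.exists_toLP_eq x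
      simp only [Set.mem_ofPred_eq, hstratum, Set.mem_preimage, Set.mem_compl_iff, Set.mem_iUnion,
        hvert, exists_prop, not_exists, not_and]
      constructor
      · rintro rfl v hv hv'
        exact hv.2 hv'
      · intro hv
        refine Set.Subset.antisymm (fun v hvP => ?_) ((hinter P).1 hx)
        by_contra hvH
        exact hv v ⟨ZnQuiver.IsSource.mem_of_generates (hBgen P) hvP, hvH⟩ hvP
    rw [heq]
    exact ((hB.sdiff.isClosed_biUnion fun v _ => isClosed_closure).isOpen_compl).preimage
      continuous_subtype_val
  · rw [Subtype.dense_iff]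
    intro x hx
    obtain ⟨P, rfl⟩ := QuiverRep.FieldPoint.exists_toLP_eq x
    have hP := (hinter P).1 hx
    refine closure_mono ?_ (QuiverRep.FieldPoint.toLP_mem_closure_iff.2
      (P.mem_closure_sources_eq hlinked hexact hB hBgen A hne hP))
    rintro _ ⟨P', hP', rfl⟩
    exact ⟨⟨P'.toLP A, (hinter P').2 hP'.ge⟩, (hstratum P').2 hP', rfl⟩
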